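/- Conventions. Let $k$ be a field of characteristic $0$. For a $k$-algebra $A$ with algebra endomorphism $\tau$ and $\tau$-derivation $\delta$ (a linear map with $\delta(uv)=\tau(u)\delta(v)+\delta(u)v$), the Ore extension $A[z;\tau,\delta]$ is the algebra containing $A$ that is a free left $A$-module on $1,z,z^2,\dots$ and satisfies $zu=\tau(u)z+\delta(u)$ for $u\in A$. If $A$ is a Hopf algebra and $r_1,r_2,x,y\in A$, a generalized Hopf-Ore extension of $A$ determined by $(r_1,r_2,x,y)$ is an Ore extension $H=A[z;\tau,\delta]$ with a Hopf algebra structure for which $A$ is a Hopf subalgebra and $\Delta z=z\otimes r_1+x\otimes y+r_2\otimes z$. It is written $A(\chi,r_1,r_2,x,y,\delta)$ when $\chi:A\to k$ is an algebra homomorphism, $\tau(u)=\chi(u_1)\,r_1u_2S(r_1)$ for all $u\in A$ (Sweedler notation), $r_1,r_2$ are group-like, $\Delta x=x\otimes 1+r_2\otimes x$, $\Delta y=y\otimes r_1+1\otimes y$, and $x=0$ if and only if $y=0$. An isomorphism of generalized Hopf-Ore extensions $H\supseteq A$, $H'\supseteq A'$ is an isomorphism of Hopf algebras $H\to H'$ taking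 $A$ onto $A'$. Enveloping algebras $U(\mathfrak g)$ carry the Hopf algebra structure in which the elements of $\mathfrak g$ are primitive; a Lie algebra character $\chi:\mathfrak g\to k$ also denotes its extension to an algebra homomorphism $U(\mathfrak g)\to k$. Proposition. Let $\mathfrak g$ be a $2$-dimensional Lie algebra over $k$. Then $\mathfrak g$ has a basis $a,b$ with $[a,b]=0$ or $[a,b]=a$. If $H$ is a generalized Hopf-Ore extension of $U(\mathfrak g)$ determined by $(r_1,r_2,x,y)$, then $r_1=r_2=1$, and, for every such basis $a,b$, $H$ is isomorphic as a generalized Hopf-Ore extension to one of the following: (a) $U(\mathfrak g)(\chi,1,1,0,0,\delta)$, where $\chi$ is a character of $\mathfrak g$ and $\delta$ restricts to a linear map $\mathfrak g\to\mathfrak g$ with $\delta([a,b])=[\delta(a),b]+[a,\delta(b)]+\chi(a)\delta(b)-\chi(b)\delta(a)$; (b) $U(\mathfrak g)(0,1,1,a,b,\delta)$, where $[a,b]=0$ and $\delta$ restricts to a linear map $\mathfrak g\to\mathfrak g$; (c) $U(\mathfrak g)(\chi,1,1,a,b,\delta)$, where $[a,b]=a$, $\chi(a)=0$, $\chi(b)=1$,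 $\delta(a)=\eta a-\tfrac12a^2$ and $\delta(b)=\zeta a+\eta b$ for some $\eta,\zeta\in k$. All these extensions exist: in (a) for every character $\chi$ and every linear $\delta|_{\mathfrak g}:\mathfrak g\to\mathfrak g$ satisfying the displayed condition, in (b) for every linear $\delta|_{\mathfrak g}:\mathfrak g\to\mathfrak g$, and in (c) for all $\eta,\zeta\in k$. The Hopf algebras of type (a), for varying $\mathfrak g$, are exactly the enveloping algebras of the $3$-dimensional Lie algebras that have a $2$-dimensional subalgebra. Precisely: every Hopf algebra of type (a) is isomorphic, as a Hopf algebra, to $U(L)$ for some $3$-dimensional Lie algebra $L$ with a $2$-dimensional subalgebra; and if $L$ is a $3$-dimensional Lie algebra and $K$ a $2$-dimensional subalgebra, then $U(L)$ is of type (a) over $U(K)$ (for some basis $a,b$ of $K$ with $[a,b]=0$ or $[a,b]=a$). If $k$ is algebraically closed, every $3$-dimensional Lie algebra over $k$ has a $2$-dimensional subalgebra. -/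

import Mathlib

open scoped TensorProduct

universe u v w

section EnvelopingHopf

attribute [local instance 100] LieRing.ofAssociativeRing

namespace UniversalEnvelopingAlgebra

variable (k : Type u) [Field k] (L : Type v) [LieRing L] [LieAlgebra k L]

variable {k L} in
/-- For a Lie algebra morphism `f : L → A` into an associative algebra, the Lie algebra morphism
`x ↦ f x ⊗ 1 + 1 ⊗ f x` from `L` to `A ⊗ A`. -/
noncomputable def primitiveLie {A : Type w} [Ring A] [Algebra k A] (f : L →ₗ⁅k⁆ A) :
    L →ₗ⁅k⁆ (A ⊗[k] A) where
  toFun x := f x ⊗ₜ[k] 1 + 1 ⊗ₜ[k] f x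
  map_add' x y := by
    rw [map_add, TensorProduct.add_tmul, TensorProduct.tmul_add]
    abel
  map_smul' r x := by
    rw [map_smul, TensorProduct.tmul_smul, ← TensorProduct.smul_tmul', ← smul_add]
    rfl
  map_lie' {x y} := by
    rw [LieHom.map_lie, LieRing.of_associative_ring_bracket, LieRing.of_associative_ring_bracket,
      TensorProduct.sub_tmul, TensorProduct.tmul_sub]
    simp only [mul_add, add_mul, Algebra.TensorProduct.tmul_mul_tmul, one_mul, mul_one]
    abel

variable {k L} in
/-- For a Lie algebra morphism `f : L → A` into an associative algebra, the Lie algebra morphism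
`x ↦ -f x` from `L` to the opposite algebra of `A`. -/
noncomputable def negOpLie {A : Type w} [Ring A] [Algebra k A] (f : L →ₗ⁅k⁆ A) :
    L →ₗ⁅k⁆ Aᵐᵒᵖ where
  toFun x := -MulOpposite.op (f x)
  map_add' x y := by
    rw [map_add, MulOpposite.op_add, neg_add]
  map_smul' r x := by
    rw [map_smul, MulOpposite.op_smul, ← smul_neg]
    rfl
  map_lie' {x y} := by
    rw [LieHom.map_lie, LieRing.of_associative_ring_bracket, LieRing.of_associative_ring_bracket,
      MulOpposite.op_sub, MulOpposite.op_mul, MulOpposite.op_mul, neg_mul_neg, neg_mul_neg, neg_sub]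

/-- The comultiplication of `U(L)`: the algebra morphism with `x ↦ x ⊗ 1 + 1 ⊗ x` for `x ∈ L`. -/
noncomputable def comulHom :
    UniversalEnvelopingAlgebra k L →ₐ[k]
      (UniversalEnvelopingAlgebra k L ⊗[k] UniversalEnvelopingAlgebra k L) :=
  lift k (primitiveLie (ι k))

/-- The counit of `U(L)`: the algebra morphism vanishing on `L`. -/
noncomputable def counitHom : UniversalEnvelopingAlgebra k L →ₐ[k] k :=
  lift k 0

/-- The antipode of `U(L)`, as an algebra morphism to the opposite algebra, with `x ↦ -x` for
`x ∈ L`. -/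
noncomputable def antipodeHom :
    UniversalEnvelopingAlgebra k L →ₐ[k] (UniversalEnvelopingAlgebra k L)ᵐᵒᵖ :=
  lift k (negOpLie (ι k))

variable {L}

theorem comulHom_ι (x : L) : comulHom k L (ι k x) = ι k x ⊗ₜ[k] 1 + 1 ⊗ₜ[k] ι k x := by
  rw [comulHom, lift_ι_apply]; rfl

theorem counitHom_ι (x : L) : counitHom k L (ι k x) = 0 := by
  rw [counitHom, lift_ι_apply]; rfl

theorem antipodeHom_ι (x : L) : antipodeHom k L (ι k x) = -MulOpposite.op (ι k x) := by
  rw [antipodeHom, lift_ι_apply]; rfl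

/-- A subalgebra of `U(L)` containing `L` is everything. -/
theorem mem_of_ι_mem (S : Subalgebra k (UniversalEnvelopingAlgebra k L))
    (h : ∀ x : L, ι k x ∈ S) (a : UniversalEnvelopingAlgebra k L) : a ∈ S := by
  let f : L →ₗ⁅k⁆ S :=
    { toFun := fun x => ⟨ι k x, h x⟩
      map_add' := fun x y => Subtype.ext (map_add (ι k) x y)
      map_smul' := fun r x => Subtype.ext (map_smul (ι k) r x)
      map_lie' := fun {x y} => Subtype.ext ((ι k).map_lie x y) }
  have e : S.val.comp (lift k f) = AlgHom.id k _ := by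
    apply hom_ext
    refine LieHom.ext fun x => ?_
    change ((lift k f (ι k x) : S) : UniversalEnvelopingAlgebra k L) = ι k x
    rw [lift_ι_apply]
    rfl
  have h2 := congrArg (fun g => g a) e
  change ((lift k f a : S) : UniversalEnvelopingAlgebra k L) = a at h2
  rw [← h2]
  exact (lift k f a).2

variable {k} in
/-- Algebra morphisms out of `U(L)` that agree on `L` are equal. -/
theorem algHom_eq {A : Type w} [Ring A] [Algebra k A]
    {f g : UniversalEnvelopingAlgebra k L →ₐ[k] A} (h : ∀ x : L, f (ι k x) = g (ι k x)) : f = g :=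
  hom_ext k (LieHom.ext h)

noncomputable instance instBialgebra : Bialgebra k (UniversalEnvelopingAlgebra k L) :=
  Bialgebra.ofAlgHom (comulHom k L) (counitHom k L)
    (algHom_eq fun x => by
      simp [-ι_apply, comulHom_ι, TensorProduct.add_tmul, TensorProduct.tmul_add,
        Algebra.TensorProduct.one_def, add_assoc])
    (algHom_eq fun x => by simp [-ι_apply, comulHom_ι, counitHom_ι])
    (algHom_eq fun x => by simp [-ι_apply, comulHom_ι, counitHom_ι])

theorem comul_ι (x : L) :
    Coalgebra.comul (R := k) (ι k x) = ι k x ⊗ₜ[k] 1 + 1 ⊗ₜ[k] ι k x :=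
  comulHom_ι k x

theorem counit_ι (x : L) : Coalgebra.counit (R := k) (ι k x) = 0 :=
  counitHom_ι k x

variable (L) in
/-- The antipode of `U(L)` as a linear endomorphism: `S(ab) = S(b) S(a)` and `S(x) = -x` on `L`. -/
noncomputable def antipodeLin :
    UniversalEnvelopingAlgebra k L →ₗ[k] UniversalEnvelopingAlgebra k L :=
  (MulOpposite.opLinearEquiv k).symm.toLinearMap ∘ₗ (antipodeHom k L).toLinearMap

theorem antipodeLin_one : antipodeLin k L 1 = 1 := by
  simp [antipodeLin]

theorem antipodeLin_ι_mul (x : L) (a : UniversalEnvelopingAlgebra k L) :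
    antipodeLin k L (ι k x * a) = -(antipodeLin k L a * ι k x) := by
  simp [-ι_apply, antipodeLin, antipodeHom_ι]

theorem antipodeLin_mul_ι (x : L) (a : UniversalEnvelopingAlgebra k L) :
    antipodeLin k L (a * ι k x) = -(ι k x * antipodeLin k L a) := by
  simp [-ι_apply, antipodeLin, antipodeHom_ι]

/-- The standard Hopf algebra structure of `U(L)`: the elements of `L` are primitive. -/
noncomputable instance instHopfAlgebra : HopfAlgebra k (UniversalEnvelopingAlgebra k L) where
  antipode := antipodeLin k L
  mul_antipode_rTensor_comul := by
    let F := LinearMap.mul' k (UniversalEnvelopingAlgebra k L) ∘ₗ (antipodeLin k L).rTensor _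
    let S : Subalgebra k (UniversalEnvelopingAlgebra k L) :=
      { carrier := {a | ∀ t, F (comulHom k L a * t) = counitHom k L a • F t}
        mul_mem' := by
          intro a b ha hb t
          rw [map_mul (comulHom k L), mul_assoc, ha, hb, map_mul, smul_smul]
        add_mem' := by
          intro a b ha hb t
          rw [map_add, add_mul, map_add, ha, hb, map_add, add_smul]
        algebraMap_mem' := by
          intro r t
          rw [AlgHom.commutes, AlgHom.commutes, ← Algebra.smul_def, map_smul]
          rfl }
    have hS := mem_of_ι_mem k S (by
      intro x t
      induction t using TensorProduct.induction_on with
      | zero => simp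
      | add s t hs ht => rw [mul_add, map_add, hs, ht, map_add, smul_add]
      | tmul p q =>
        simp [-ι_apply, F, comulHom_ι, counitHom_ι, add_mul, antipodeLin_ι_mul, mul_assoc])
    ext a
    have h := hS a 1
    rw [mul_one, Algebra.TensorProduct.one_def] at h
    refine Eq.trans h ?_
    simp only [F, LinearMap.comp_apply, LinearMap.rTensor_tmul, LinearMap.mul'_apply,
      antipodeLin_one, mul_one]
    exact (Algebra.algebraMap_eq_smul_one _).symm
  mul_antipode_lTensor_comul := by
    let F := LinearMap.mul' k (UniversalEnvelopingAlgebra k L) ∘ₗ (antipodeLin k L).lTensor _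
    let S : Subalgebra k (UniversalEnvelopingAlgebra k L) :=
      { carrier := {a | ∀ t, F (t * comulHom k L a) = counitHom k L a • F t}
        mul_mem' := by
          intro a b ha hb t
          rw [map_mul (comulHom k L), ← mul_assoc, hb, ha, map_mul, smul_smul, mul_comm]
        add_mem' := by
          intro a b ha hb t
          rw [map_add, mul_add, map_add, ha, hb, map_add, add_smul]
        algebraMap_mem' := by
          intro r t
          rw [AlgHom.commutes, AlgHom.commutes, ← Algebra.commutes, ← Algebra.smul_def, map_smul]
          rfl }
    have hS := mem_of_ι_mem k S (by
      intro x t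
      induction t using TensorProduct.induction_on with
      | zero => simp
      | add s t hs ht => rw [add_mul, map_add, hs, ht, map_add, smul_add]
      | tmul p q =>
        simp [-ι_apply, F, comulHom_ι, counitHom_ι, mul_add, antipodeLin_mul_ι, mul_assoc])
    ext a
    have h := hS a 1
    rw [one_mul, Algebra.TensorProduct.one_def] at h
    refine Eq.trans h ?_
    simp only [F, LinearMap.comp_apply, LinearMap.lTensor_tmul, LinearMap.mul'_apply,
      antipodeLin_one, mul_one]
    exact (Algebra.algebraMap_eq_smul_one _).symm

end UniversalEnvelopingAlgebra

end EnvelopingHopf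

section HopfOre

/-- `H` is the Ore extension `A[z; τ, δ]`: `δ` is a `τ`-derivation of `A`, the relation
`z a = τ(a) z + δ(a)` holds in `H`, and `1, z, z², …` is a basis of `H` as a left `A`-module
(so `A` embeds in `H` by `ι`). This determines `H` up to a unique isomorphism. -/
structure IsOreExtension {k : Type u} [Field k] {A : Type v} [Ring A] [Algebra k A]
    {H : Type w} [Ring H] [Algebra k H] (ι : A →ₐ[k] H) (z : H)
    (τ : A →ₐ[k] A) (δ : A →ₗ[k] A) : Prop where
  leibniz : ∀ a b : A, δ (a * b) = τ a * δ b + δ a * b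
  rel : ∀ a : A, z * ι a = ι (τ a) * z + ι (δ a)
  basis : Function.Bijective fun p : ℕ →₀ A => p.sum fun i c => ι c * z ^ i

variable {k : Type u} [Field k] {A : Type v} [Ring A] [HopfAlgebra k A]

/-- `H = A[z; τ, δ]` is a Hopf algebra having `A` as a Hopf subalgebra (embedded by `ι`), and its
structure is determined by `(r₁, r₂, x, y)`: `Δ z = z ⊗ r₁ + x ⊗ y + r₂ ⊗ z`. -/
structure IsGeneralizedHopfOre {H : Type w} [Ring H] [HopfAlgebra k H] (ι : A →ₐc[k] H) (z : H)
    (τ : A →ₐ[k] A) (δ : A →ₗ[k] A) (r₁ r₂ x y : A) : Prop where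
  ore : IsOreExtension (ι : A →ₐ[k] H) z τ δ
  comul_z : Coalgebra.comul (R := k) z = z ⊗ₜ[k] ι r₁ + ι x ⊗ₜ[k] ι y + ι r₂ ⊗ₜ[k] z

/-- `a` is `(g, h)`-primitive: `Δ a = a ⊗ g + h ⊗ a`. -/
def IsSkewPrimitive (k : Type u) [Field k] {A : Type v} [Ring A] [HopfAlgebra k A]
    (g h a : A) : Prop :=
  Coalgebra.comul (R := k) a = a ⊗ₜ[k] g + h ⊗ₜ[k] a

/-- For a character `χ` and a group-like element `r`, the map `a ↦ χ(a₁) Ad_r(a₂)`, where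
`Ad_r(b) = r b S(r)`. -/
noncomputable def twistedAd (χ : A →ₐ[k] k) (r a : A) : A :=
  r * TensorProduct.lid k A ((χ.toLinearMap.rTensor A) (Coalgebra.comul (R := k) a)) *
    HopfAlgebra.antipode k r

/-- `H`, with the embedding `ι` of `A` and the element `z`, is the generalized Hopf-Ore extension
`A(χ, r₁, r₂, x, y, δ)`. (The compatibilities between the data that make `Δ` multiplicative follow
from the existence of the Hopf algebra `H`.) -/
structure IsHopfOreExtension (χ : A →ₐ[k] k) (r₁ r₂ x y : A) (δ : A →ₗ[k] A)
    {H : Type w} [Ring H] [HopfAlgebra k H] (ι : A →ₐc[k] H) (z : H) : Prop where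
  groupLike₁ : IsGroupLikeElem k r₁
  groupLike₂ : IsGroupLikeElem k r₂
  primitive_x : IsSkewPrimitive k 1 r₂ x
  primitive_y : IsSkewPrimitive k r₁ 1 y
  zero_iff : x = 0 ↔ y = 0
  ext : ∃ τ : A →ₐ[k] A, (∀ a, τ a = twistedAd χ r₁ a) ∧
    IsGeneralizedHopfOre ι z τ δ r₁ r₂ x y

/-- Isomorphism of generalized Hopf-Ore extensions: an isomorphism of Hopf algebras (equivalently
of bialgebras) `Ψ : H → H'` that takes `A` onto `A'`. -/
def AreIsomorphicExtensions {A' : Type*} [Ring A'] [HopfAlgebra k A']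
    {H : Type*} [Ring H] [HopfAlgebra k H] {H' : Type*} [Ring H'] [HopfAlgebra k H']
    (ι : A →ₐc[k] H) (ι' : A' →ₐc[k] H') : Prop :=
  ∃ Ψ : H ≃ₐc[k] H', Ψ '' Set.range ι = Set.range ι'

end HopfOre

section TwoDimensional

open UniversalEnvelopingAlgebra

variable {k : Type u} [Field k] {g : Type v} [LieRing g] [LieAlgebra k g]

/-- The basis `a = B 0`, `b = B 1` satisfies `[a, b] = 0` or `[a, b] = a`. -/
def IsNormalizedBasis (B : Module.Basis (Fin 2) k g) : Prop :=
  ⁅B 0, B 1⁆ = 0 ∨ ⁅B 0, B 1⁆ = B 0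

/-- The condition `d([a,b]) = [d(a),b] + [a,d(b)] + χ(a) d(b) - χ(b) d(a)` on a linear map
`d : 𝔤 → 𝔤`, for the basis `a, b` of `𝔤`. -/
def IsTwistedDerivation (B : Module.Basis (Fin 2) k g) (χ : LieAlgebra.LieCharacter k g)
    (d : g →ₗ[k] g) : Prop :=
  d ⁅B 0, B 1⁆ = ⁅d (B 0), B 1⁆ + ⁅B 0, d (B 1)⁆ + χ (B 0) • d (B 1) - χ (B 1) • d (B 0)

variable {H : Type w} [Ring H] [HopfAlgebra k H]

/-- `H = U(𝔤)(χ, 1, 1, 0, 0, δ)` with `δ|_𝔤 = d : 𝔤 → 𝔤` a twisted derivation: a usual Hopf-Ore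
extension. The character of `U(𝔤)` is the one extending the Lie algebra character `χ`. -/
def IsUsualType (B : Module.Basis (Fin 2) k g) (χ : LieAlgebra.LieCharacter k g) (d : g →ₗ[k] g)
    (ι' : UniversalEnvelopingAlgebra k g →ₐc[k] H) (z : H) : Prop :=
  IsTwistedDerivation B χ d ∧
  ∃ δ : UniversalEnvelopingAlgebra k g →ₗ[k] UniversalEnvelopingAlgebra k g,
    (∀ c : g, δ (ι k c) = ι k (d c)) ∧
    IsHopfOreExtension (lift k χ) 1 1 0 0 δ ι' z

/-- `H = U(𝔤)(0, 1, 1, a, b, δ)` with `[a, b] = 0` and `δ|_𝔤 = d : 𝔤 → 𝔤`. The character of `U(𝔤)`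
is the one that vanishes on `𝔤`. -/
def IsAbelianType (B : Module.Basis (Fin 2) k g) (d : g →ₗ[k] g)
    (ι' : UniversalEnvelopingAlgebra k g →ₐc[k] H) (z : H) : Prop :=
  ⁅B 0, B 1⁆ = 0 ∧
  ∃ δ : UniversalEnvelopingAlgebra k g →ₗ[k] UniversalEnvelopingAlgebra k g,
    (∀ c : g, δ (ι k c) = ι k (d c)) ∧
    IsHopfOreExtension (lift k (0 : LieAlgebra.LieCharacter k g)) 1 1
      (ι k (B 0)) (ι k (B 1)) δ ι' z

/-- `H = U(𝔤)(χ, 1, 1, a, b, δ)` with `[a, b] = a`, `χ(a) = 0`, `χ(b) = 1`,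
`δ(a) = η a - (1/2) a²` and `δ(b) = ζ a + η b`. -/
def IsNonabelianType (B : Module.Basis (Fin 2) k g) (η ζ : k)
    (ι' : UniversalEnvelopingAlgebra k g →ₐc[k] H) (z : H) : Prop :=
  ⁅B 0, B 1⁆ = B 0 ∧
  ∃ (χ : LieAlgebra.LieCharacter k g)
    (δ : UniversalEnvelopingAlgebra k g →ₗ[k] UniversalEnvelopingAlgebra k g),
    χ (B 0) = 0 ∧ χ (B 1) = 1 ∧
    δ (ι k (B 0)) = η • ι k (B 0) - (1 / 2 : k) • ι k (B 0) ^ 2 ∧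
    δ (ι k (B 1)) = ζ • ι k (B 0) + η • ι k (B 1) ∧
    IsHopfOreExtension (lift k χ) 1 1 (ι k (B 0)) (ι k (B 1)) δ ι' z

end TwoDimensional

/-!
Everything rests on two properties of the Ore extension `A[z; τ, δ]`: it exists
(`exists_isOreExtension`, as operators on `⨁ A zⁱ`), and it is universal among algebras with
elements satisfying `z a = τ(a) z + δ(a)` (`IsOreExtension.exists_algHom`). Conversely an algebra
generated by `A` and `z` with this relation is the Ore extension as soon as it maps to the existing
one (`IsOreExtension.of_algHom`). This gives the Poincaré–Birkhoff–Witt theorem where it is needed: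
for `U(𝔤)` over `k[a]`, and for `U(L)` over `U(K)` with `K` of codimension one in `L`. The
relations need only be checked on generators, so all verifications reduce to the basis vectors
`a, b` of `𝔤`; in particular a `τ`-derivation of `U(𝔤)` is prescribed on `a, b`
(`exists_twistedDerivation`).

In the basis `aⁱ bʲ` the functionals dual to `a` and `b` act on `U(𝔤)` as `∂/∂a` and `∂/∂b`.
In characteristic `0` it follows that the only group-like element is `1` and that the primitive
elements are those of `𝔤`.

For the classification, coassociativity at `z` shows that `r₁, r₂` are group-like, hence `1`, and
that `x ⊗ y` is scalar or `x, y` are primitive (`scalar_or_primitive_of_cocycle`). Replacing `z` by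
`c z + q` with `q ∈ U(𝔤)` of degree at most two kills the scalar and the symmetric part of `x ⊗ y`,
so that `x ⊗ y = 0` or `x ⊗ y = a ⊗ b` (`IsGeneralizedHopfOre.exists_reduced`). Applying `Δ` to
`z u = τ(u) z + δ(u)` for `u ∈ 𝔤` gives `τ(u) = u + χ(u)` and
`Δ δ(u) = δ(u) ⊗ 1 + 1 ⊗ δ(u) + [x ⊗ y, Δ u] - χ(u) x ⊗ y`. Cocommutativity of `U(𝔤)` then
determines `χ`, and the primitive elements being `𝔤` determines the shape of `δ`.

For existence, the same formula says that the comultiplication respects the defining relation; the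
antipode has `S(z) = -z + xy` (`exists_isGeneralizedHopfOre`). A Hopf algebra of the first type is
generated by the Lie algebra `𝔤 + k z` and is its enveloping algebra, and over an algebraically
closed field an eigenvector of `ad x` on `L / k x` provides a two-dimensional subalgebra.
-/

/-! ### Ore extensions -/

section OreAlgebra

variable {k : Type u} [Field k] {A : Type v} [Ring A] [Algebra k A]
  {R : Type*} [Ring R] [Algebra k R]

/-- The left polynomial `∑ f(cᵢ) Zⁱ` in `Z` with coefficients from `A`, as a `k`-linear function of
its coefficients. -/
noncomputable def oreSum (f : A →ₐ[k] R) (Z : R) : (ℕ →₀ A) →ₗ[k] R :=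
  Finsupp.lsum k fun i => LinearMap.mulRight k (Z ^ i) ∘ₗ f.toLinearMap

theorem oreSum_single (f : A →ₐ[k] R) (Z : R) (i : ℕ) (a : A) :
    oreSum f Z (Finsupp.single i a) = f a * Z ^ i := by
  simp [oreSum]

theorem oreSum_apply (f : A →ₐ[k] R) (Z : R) (p : ℕ →₀ A) :
    oreSum f Z p = p.sum fun i c => f c * Z ^ i := rfl

theorem oreSum_mem (f : A →ₐ[k] R) (Z : R) (S : Subalgebra k R) (hf : ∀ a, f a ∈ S) (hZ : Z ∈ S)
    (p : ℕ →₀ A) : oreSum f Z p ∈ S := by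
  rw [oreSum_apply]
  exact S.sum_mem fun i _ => S.mul_mem (hf _) (S.pow_mem hZ i)

theorem map_oreSum {R' : Type*} [Ring R'] [Algebra k R'] (G : R →ₐ[k] R') (f : A →ₐ[k] R) (Z : R)
    (p : ℕ →₀ A) : G (oreSum f Z p) = oreSum (G.comp f) (G Z) p := by
  simp only [oreSum_apply, Finsupp.sum, map_sum, map_mul, map_pow, AlgHom.comp_apply]

theorem oreSum_smul (f : A →ₐ[k] R) (Z : R) (a : A) (p : ℕ →₀ A) :
    oreSum f Z (a • p) = f a * oreSum f Z p := by
  induction p using Finsupp.induction_linear with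
  | zero => simp
  | add p q hp hq => rw [smul_add, map_add, hp, hq, map_add, mul_add]
  | single i c => rw [Finsupp.smul_single, oreSum_single, oreSum_single, smul_eq_mul, map_mul,
      mul_assoc]

/-- Left multiplication by the variable of the Ore extension, on the coefficients:
`c zⁱ ↦ τ(c) zⁱ⁺¹ + δ(c) zⁱ`. -/
noncomputable def oreShift (τ : A →ₐ[k] A) (δ : A →ₗ[k] A) : (ℕ →₀ A) →ₗ[k] (ℕ →₀ A) :=
  Finsupp.lsum k fun i =>
    Finsupp.lsingle (i + 1) ∘ₗ τ.toLinearMap + Finsupp.lsingle i ∘ₗ δ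

theorem oreShift_single (τ : A →ₐ[k] A) (δ : A →ₗ[k] A) (i : ℕ) (c : A) :
    oreShift τ δ (Finsupp.single i c) =
      Finsupp.single (i + 1) (τ c) + Finsupp.single i (δ c) := by
  simp [oreShift]

theorem oreSum_oreShift {f : A →ₐ[k] R} {Z : R} {τ : A →ₐ[k] A} {δ : A →ₗ[k] A}
    (hrel : ∀ a, Z * f a = f (τ a) * Z + f (δ a)) (p : ℕ →₀ A) :
    oreSum f Z (oreShift τ δ p) = Z * oreSum f Z p := by
  induction p using Finsupp.induction_linear with
  | zero => simp
  | add p q hp hq => rw [map_add, map_add, hp, hq, map_add, mul_add]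
  | single i c =>
    rw [oreShift_single, map_add, oreSum_single, oreSum_single, oreSum_single, ← mul_assoc, hrel,
      add_mul, pow_succ', mul_assoc]

theorem twistedDerivation_one {τ : A →ₐ[k] A} {δ : A →ₗ[k] A}
    (hδ : ∀ a b : A, δ (a * b) = τ a * δ b + δ a * b) : δ 1 = 0 := by
  have h := hδ 1 1
  simpa using h

/-- The relation `Z f(a) = f(τ a) Z + f(δ a)` holds on a subalgebra; thus it can be checked on
generators of `A`. -/
def oreRelSubalgebra {τ : A →ₐ[k] A} {δ : A →ₗ[k] A}
    (hδ : ∀ a b : A, δ (a * b) = τ a * δ b + δ a * b) (f : A →ₐ[k] R) (Z : R) :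
    Subalgebra k A where
  carrier := {a | Z * f a = f (τ a) * Z + f (δ a)}
  mul_mem' {a b} ha hb := by
    change Z * f (a * b) = _
    rw [map_mul, ← mul_assoc, ha, add_mul, mul_assoc, hb, hδ]
    simp only [map_mul, map_add, mul_add]
    noncomm_ring
  add_mem' {a b} ha hb := by
    change Z * f (a + b) = _
    rw [map_add, mul_add, ha, hb]
    simp only [map_add, add_mul]
    abel
  algebraMap_mem' r := by
    change Z * f _ = _
    rw [Algebra.algebraMap_eq_smul_one, map_smul, map_smul, map_smul, map_one, map_smul, map_smul,
      map_one, map_one, twistedDerivation_one hδ]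
    simp

/-- If `Z f(a) = f(τ a) Z + f(δ a)` in `R` and the coefficients of a left polynomial `∑ f(cᵢ) Zⁱ`
can be read off from its value, then these polynomials form an Ore extension `A[z; τ, δ]`. -/
theorem exists_isOreExtension_of_leftInverse {R : Type w} [Ring R] [Algebra k R]
    {τ : A →ₐ[k] A} {δ : A →ₗ[k] A}
    (hδ : ∀ a b : A, δ (a * b) = τ a * δ b + δ a * b) {f : A →ₐ[k] R} {Z : R}
    (hrel : ∀ a, Z * f a = f (τ a) * Z + f (δ a)) {ev : R → (ℕ →₀ A)}
    (hev : ∀ p, ev (oreSum f Z p) = p) :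
    ∃ (H : Type w) (_ : Ring H) (_ : Algebra k H) (ι : A →ₐ[k] H) (z : H),
      IsOreExtension ι z τ δ := by
  -- the left stabilizer of the set of left polynomials in `Z` is that set itself
  let T : Subalgebra k R :=
    { carrier := {e | ∀ q, ∃ q', e * oreSum f Z q = oreSum f Z q'}
      mul_mem' := by
        intro a b ha hb q
        obtain ⟨q', h'⟩ := hb q
        obtain ⟨q'', h''⟩ := ha q'
        exact ⟨q'', by rw [mul_assoc, h', h'']⟩
      add_mem' := by
        intro a b ha hb q
        obtain ⟨q', h'⟩ := hb q
        obtain ⟨q'', h''⟩ := ha q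
        exact ⟨q'' + q', by rw [add_mul, h', h'', map_add]⟩
      algebraMap_mem' := by
        intro r q
        exact ⟨r • q, by rw [map_smul, Algebra.smul_def]⟩ }
  have hfT : ∀ a, f a ∈ T := fun a q => ⟨a • q, (oreSum_smul f Z a q).symm⟩
  have hZT : Z ∈ T := fun q => ⟨oreShift τ δ q, (oreSum_oreShift hrel q).symm⟩
  refine ⟨T, inferInstance, inferInstance, f.codRestrict T hfT, ⟨Z, hZT⟩, hδ, ?_, ?_⟩
  · intro a
    exact Subtype.ext (hrel a)
  · have hval : ∀ p, ((oreSum (f.codRestrict T hfT) ⟨Z, hZT⟩ p : T) :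
        R) = oreSum f Z p := fun p => map_oreSum T.val _ _ p
    change Function.Bijective (oreSum (f.codRestrict T hfT) (⟨Z, hZT⟩ : T))
    constructor
    · intro p q h
      rw [← hev p, ← hev q, ← hval, ← hval, h]
    · rintro ⟨e, he⟩
      obtain ⟨q, hq⟩ := he (Finsupp.single 0 1)
      refine ⟨q, Subtype.ext ?_⟩
      rw [hval, ← hq, oreSum_single]
      simp

/-- The Ore extension `A[z; τ, δ]` exists: it is realized by operators on the left `A`-module
`⨁ A zⁱ`. -/
theorem exists_isOreExtension (τ : A →ₐ[k] A) (δ : A →ₗ[k] A)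
    (hδ : ∀ a b : A, δ (a * b) = τ a * δ b + δ a * b) :
    ∃ (H : Type v) (_ : Ring H) (_ : Algebra k H) (ι : A →ₐ[k] H) (z : H),
      IsOreExtension ι z τ δ := by
  let f : A →ₐ[k] Module.End k (ℕ →₀ A) := Algebra.lsmul k k (ℕ →₀ A)
  let Z : Module.End k (ℕ →₀ A) := oreShift τ δ
  have hf : ∀ a p, f a p = a • p := fun a p => rfl
  have hrel : ∀ a, Z * f a = f (τ a) * Z + f (δ a) := by
    intro a
    ext i c : 2
    simp only [hf, Z, LinearMap.comp_apply, Finsupp.lsingle_apply, Module.End.mul_apply,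
      LinearMap.add_apply, oreShift_single, Finsupp.smul_single, smul_eq_mul, hδ, map_mul,
      Finsupp.single_add, smul_add, add_assoc]
  have hpow : ∀ i : ℕ, (Z ^ i) (Finsupp.single 0 1) = Finsupp.single i 1 := by
    intro i
    induction i with
    | zero => simp
    | succ n ih =>
      rw [pow_succ', Module.End.mul_apply, ih, oreShift_single, map_one,
        twistedDerivation_one hδ]
      simp
  -- an operator `∑ cᵢ Zⁱ` is determined by its value at `1 ∈ ⨁ A zⁱ`
  have heval : ∀ p, oreSum f Z p (Finsupp.single 0 1) = p := by
    intro p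
    induction p using Finsupp.induction_linear with
    | zero => simp
    | add p q hp hq => rw [map_add, LinearMap.add_apply, hp, hq]
    | single i c =>
      rw [oreSum_single, Module.End.mul_apply, hpow, hf, Finsupp.smul_single, smul_eq_mul,
        mul_one]
  exact exists_isOreExtension_of_leftInverse hδ hrel
    (ev := fun e : Module.End k (ℕ →₀ A) => e (Finsupp.single 0 1)) heval

namespace IsOreExtension

variable {H : Type w} [Ring H] [Algebra k H] {ι : A →ₐ[k] H} {z : H} {τ : A →ₐ[k] A}
  {δ : A →ₗ[k] A}

theorem oreSum_bijective (h : IsOreExtension ι z τ δ) : Function.Bijective (oreSum ι z) := h.basis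

theorem mem_of_mem (h : IsOreExtension ι z τ δ) (S : Subalgebra k H) (hι : ∀ a, ι a ∈ S)
    (hz : z ∈ S) (x : H) : x ∈ S := by
  obtain ⟨p, rfl⟩ := h.oreSum_bijective.2 x
  exact oreSum_mem ι z S hι hz p

theorem algHom_ext (h : IsOreExtension ι z τ δ) {F G : H →ₐ[k] R}
    (hι : ∀ a, F (ι a) = G (ι a)) (hz : F z = G z) : F = G :=
  AlgHom.ext fun x => h.mem_of_mem (AlgHom.equalizer F G) hι hz x

/-- The universal property of the Ore extension. -/
theorem exists_algHom (h : IsOreExtension ι z τ δ) (f : A →ₐ[k] R) (Z : R)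
    (hrel : ∀ a, Z * f a = f (τ a) * Z + f (δ a)) :
    ∃ F : H →ₐ[k] R, (∀ a, F (ι a) = f a) ∧ F z = Z := by
  let e : (ℕ →₀ A) ≃ₗ[k] H := LinearEquiv.ofBijective (oreSum ι z) h.oreSum_bijective
  let F₀ : H →ₗ[k] R := oreSum f Z ∘ₗ e.symm.toLinearMap
  have hF : ∀ p, F₀ (oreSum ι z p) = oreSum f Z p := fun p =>
    congrArg (oreSum f Z) (e.symm_apply_apply p)
  have h1 : ∀ a x, F₀ (ι a * x) = f a * F₀ x := by
    intro a x
    obtain ⟨p, rfl⟩ := h.oreSum_bijective.2 x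
    rw [← oreSum_smul, hF, hF, oreSum_smul]
  have h2 : ∀ x, F₀ (z * x) = Z * F₀ x := by
    intro x
    obtain ⟨p, rfl⟩ := h.oreSum_bijective.2 x
    rw [← oreSum_oreShift h.rel, hF, hF, oreSum_oreShift hrel]
  have hone : F₀ 1 = 1 := by
    have := hF (Finsupp.single 0 1)
    simpa [oreSum_single] using this
  have hpow : ∀ (i : ℕ) x, F₀ (z ^ i * x) = Z ^ i * F₀ x := by
    intro i
    induction i with
    | zero => simp
    | succ n ih => intro x; rw [pow_succ', mul_assoc, h2, ih, pow_succ', mul_assoc]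
  have hmul : ∀ x y, F₀ (x * y) = F₀ x * F₀ y := by
    intro x y
    obtain ⟨p, rfl⟩ := h.oreSum_bijective.2 x
    induction p using Finsupp.induction_linear with
    | zero => simp
    | add p q hp hq => rw [map_add, add_mul, map_add, hp, hq, map_add, add_mul]
    | single i c => rw [hF, oreSum_single, oreSum_single, mul_assoc, h1, hpow, mul_assoc]
  refine ⟨AlgHom.ofLinearMap F₀ hone hmul, fun a => ?_, ?_⟩
  · have := hF (Finsupp.single 0 a)
    simpa [oreSum_single] using this
  · have := hF (Finsupp.single 1 1)
    simpa [oreSum_single] using this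

/-- An algebra `H`, generated by `ι A` and by `z`, in which `z a = τ(a) z + δ(a)` holds, is the Ore
extension as soon as it maps to a known Ore extension compatibly with `ι` and `z`. -/
theorem of_algHom {H₀ : Type*} [Ring H₀] [Algebra k H₀] {ι₀ : A →ₐ[k] H₀} {z₀ : H₀}
    (h₀ : IsOreExtension ι₀ z₀ τ δ) (hrel : ∀ a, z * ι a = ι (τ a) * z + ι (δ a))
    (G : H →ₐ[k] H₀) (hGι : ∀ a, G (ι a) = ι₀ a) (hGz : G z = z₀)
    (hgen : ∀ S : Subalgebra k H, (∀ a, ι a ∈ S) → z ∈ S → ∀ x, x ∈ S) :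
    IsOreExtension ι z τ δ := by
  obtain ⟨F, hFι, hFz⟩ := h₀.exists_algHom ι z hrel
  have hFG : ∀ x, F (G x) = x :=
    hgen (AlgHom.equalizer (F.comp G) (AlgHom.id k H))
      (fun a => by simp [AlgHom.mem_equalizer, hGι, hFι])
      (by simp [AlgHom.mem_equalizer, hGz, hFz])
  have hcomp : G.comp ι = ι₀ := AlgHom.ext hGι
  have hcomp' : F.comp ι₀ = ι := AlgHom.ext hFι
  refine ⟨h₀.leibniz, hrel, ?_⟩
  change Function.Bijective (oreSum ι z)
  constructor
  · intro p q hpq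
    apply h₀.oreSum_bijective.1
    rw [← hcomp, ← hGz, ← map_oreSum, ← map_oreSum, hpq]
  · intro x
    obtain ⟨p, hp⟩ := h₀.oreSum_bijective.2 (G x)
    refine ⟨p, ?_⟩
    rw [← hFG x, ← hp, map_oreSum, hcomp', hFz]

/-- In an Ore extension the variable `z` may be replaced by `c z + w`, with `c` a nonzero scalar and
`w ∈ A`; the twisted derivation becomes `c δ(a) + w a - τ(a) w`. -/
theorem affine_change (h : IsOreExtension ι z τ δ) {c : k} (hc : c ≠ 0) (w : A) {δ' : A →ₗ[k] A}
    (hδ' : ∀ a, δ' a = c • δ a + w * a - τ a * w) :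
    IsOreExtension ι (c • z + ι w) τ δ' := by
  have hleib : ∀ a b : A, δ' (a * b) = τ a * δ' b + δ' a * b := by
    intro a b
    simp only [hδ', h.leibniz, map_mul, smul_add, mul_sub, mul_add, sub_mul, add_mul,
      mul_smul_comm, smul_mul_assoc, mul_assoc]
    abel
  obtain ⟨O, _, _, ι₀, z₀, h₀⟩ := exists_isOreExtension τ δ' hleib
  obtain ⟨G, hGι, hGz⟩ := h.exists_algHom ι₀ (c⁻¹ • (z₀ - ι₀ w)) (by
    intro a
    rw [smul_mul_assoc, sub_mul, h₀.rel, hδ', mul_smul_comm, mul_sub]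
    have : ι₀ (δ a) = c⁻¹ • ι₀ (c • δ a) := by
      rw [map_smul, smul_smul, inv_mul_cancel₀ hc, one_smul]
    rw [this, ← smul_add]
    congr 1
    simp only [map_sub, map_add, map_mul]
    abel)
  refine h₀.of_algHom ?_ G hGι ?_ ?_
  · intro a
    rw [add_mul, smul_mul_assoc, h.rel, hδ', mul_add, mul_smul_comm, smul_add]
    simp only [map_sub, map_add, map_mul, map_smul]
    abel
  · rw [map_add, map_smul, hGz, hGι, smul_smul, mul_inv_cancel₀ hc, one_smul, sub_add_cancel]
  · intro S hS hz
    refine h.mem_of_mem S hS ?_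
    have : z = c⁻¹ • ((c • z + ι w) - ι w) := by
      rw [add_sub_cancel_right, smul_smul, inv_mul_cancel₀ hc, one_smul]
    rw [this]
    exact S.smul_mem (S.sub_mem hz (hS w)) _

theorem injective (h : IsOreExtension ι z τ δ) : Function.Injective ι := by
  intro a b hab
  have := h.oreSum_bijective.1 (a₁ := Finsupp.single 0 a) (a₂ := Finsupp.single 0 b)
    (by rw [oreSum_single, oreSum_single, hab])
  exact Finsupp.single_injective 0 this

/-- The coefficient of `z` is a linear functional (with values in `A`), vanishing on `ι A`. -/
theorem exists_coeff (h : IsOreExtension ι z τ δ) :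
    ∃ c : H →ₗ[k] A, (∀ a, c (ι a) = 0) ∧ ∀ a, c (ι a * z) = a := by
  let e : (ℕ →₀ A) ≃ₗ[k] H := LinearEquiv.ofBijective (oreSum ι z) h.oreSum_bijective
  have he : ∀ p, e.symm (oreSum ι z p) = p := e.symm_apply_apply
  refine ⟨Finsupp.lapply 1 ∘ₗ e.symm.toLinearMap, fun a => ?_, fun a => ?_⟩
  · have := he (Finsupp.single 0 a)
    rw [oreSum_single, pow_zero, mul_one] at this
    simp [this]
  · have := he (Finsupp.single 1 a)
    rw [oreSum_single, pow_one] at this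
    simp [this]

end IsOreExtension

end OreAlgebra

/-! ### Contractions of tensors and two-dimensional Lie algebras -/

section Contraction

variable {k : Type u} [Field k] {M N : Type*} [AddCommGroup M] [Module k M] [AddCommGroup N]
  [Module k N]

/-- Contraction of the first tensor factor with a linear functional: `m ⊗ n ↦ φ(m) n`. -/
noncomputable def sliceLeft (N : Type*) [AddCommGroup N] [Module k N] (φ : M →ₗ[k] k) :
    M ⊗[k] N →ₗ[k] N :=
  (TensorProduct.lid k N).toLinearMap ∘ₗ φ.rTensor N

theorem sliceLeft_tmul (φ : M →ₗ[k] k) (m : M) (n : N) :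
    sliceLeft N φ (m ⊗ₜ n) = φ m • n := by
  simp [sliceLeft]

/-- Contraction of the second tensor factor with a linear functional: `m ⊗ n ↦ φ(n) m`. -/
noncomputable def sliceRight (M : Type*) [AddCommGroup M] [Module k M] (φ : N →ₗ[k] k) :
    M ⊗[k] N →ₗ[k] M :=
  (TensorProduct.rid k M).toLinearMap ∘ₗ φ.lTensor M

theorem sliceRight_tmul (φ : N →ₗ[k] k) (m : M) (n : N) :
    sliceRight M φ (m ⊗ₜ n) = φ n • m := by
  simp [sliceRight]

theorem exists_functional_eq_one {m : M} (hm : m ≠ 0) : ∃ φ : M →ₗ[k] k, φ m = 1 := by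
  obtain ⟨φ, hφ⟩ := Module.Projective.exists_dual_ne_zero k hm
  exact ⟨(φ m)⁻¹ • φ, by simp [hφ]⟩

section Coalgebra

variable {C : Type*} [AddCommGroup C] [Module k C] [Coalgebra k C]

theorem sliceLeft_counit_comul (c : C) :
    sliceLeft C (Coalgebra.counit (R := k)) (Coalgebra.comul c) = c := by
  rw [sliceLeft, LinearMap.comp_apply, Coalgebra.rTensor_counit_comul]
  simp

theorem sliceRight_counit_comul (c : C) :
    sliceRight C (Coalgebra.counit (R := k)) (Coalgebra.comul c) = c := by
  rw [sliceRight, LinearMap.comp_apply, Coalgebra.lTensor_counit_comul]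
  simp

end Coalgebra

theorem counit_eq_zero_of_primitive {A : Type*} [Ring A] [Bialgebra k A] {x : A}
    (hx : Coalgebra.comul (R := k) x = x ⊗ₜ 1 + 1 ⊗ₜ x) : Coalgebra.counit (R := k) x = 0 := by
  have h := sliceLeft_counit_comul (k := k) x
  rw [hx, map_add, sliceLeft_tmul, sliceLeft_tmul, Bialgebra.counit_one, one_smul,
    add_eq_right] at h
  have h' := congrArg (Coalgebra.counit (R := k)) h
  rwa [map_smul, Bialgebra.counit_one, map_zero, smul_eq_mul, mul_one] at h'

end Contraction

section TwoDimensionalLie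

attribute [local instance 100] LieRing.ofAssociativeRing

open UniversalEnvelopingAlgebra

variable {k : Type u} [Field k] {g : Type v} [LieRing g] [LieAlgebra k g]
  (B : Module.Basis (Fin 2) k g)

theorem basis_expand (x : g) : x = B.repr x 0 • B 0 + B.repr x 1 • B 1 := by
  conv_lhs => rw [← B.sum_repr x, Fin.sum_univ_two]

theorem lie_eq_smul_lie_basis (x y : g) :
    ⁅x, y⁆ = (B.repr x 0 * B.repr y 1 - B.repr x 1 * B.repr y 0) • ⁅B 0, B 1⁆ := by
  conv_lhs => rw [basis_expand B x, basis_expand B y]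
  simp only [lie_add, add_lie, lie_smul, smul_lie, lie_self, smul_zero, zero_add, add_zero]
  rw [← lie_skew (B 1) (B 0)]
  module

/-- A linear map out of a two-dimensional Lie algebra that preserves the bracket of the two basis
vectors is a Lie algebra morphism. -/
def lieHomOfBasis {R : Type*} [LieRing R] [LieAlgebra k R] (φ : g →ₗ[k] R)
    (h : φ ⁅B 0, B 1⁆ = ⁅φ (B 0), φ (B 1)⁆) : g →ₗ⁅k⁆ R where
  __ := φ
  map_lie' {x y} := by
    have hx := congrArg φ (basis_expand B x)
    have hy := congrArg φ (basis_expand B y)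
    change φ ⁅x, y⁆ = ⁅φ x, φ y⁆
    rw [hx, hy, lie_eq_smul_lie_basis B, map_smul, h, map_add, map_add, map_smul, map_smul,
      map_smul, map_smul]
    simp only [lie_add, add_lie, lie_smul, smul_lie, lie_self, smul_zero, zero_add, add_zero]
    rw [← lie_skew (φ (B 1)) (φ (B 0))]
    module

theorem lieHomOfBasis_apply {R : Type*} [LieRing R] [LieAlgebra k R] (φ : g →ₗ[k] R)
    (h : φ ⁅B 0, B 1⁆ = ⁅φ (B 0), φ (B 1)⁆) (x : g) : lieHomOfBasis B φ h x = φ x := rfl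

variable {B}

theorem IsNormalizedBasis.exists_lie_eq (hB : IsNormalizedBasis B) :
    ∃ s : k, ⁅B 0, B 1⁆ = s • B 0 := by
  rcases hB with h | h
  · exact ⟨0, by rw [h, zero_smul]⟩
  · exact ⟨1, by rw [h, one_smul]⟩

theorem ι_lie (x y : g) : ι k ⁅x, y⁆ = ι k x * ι k y - ι k y * ι k x := by
  rw [LieHom.map_lie, LieRing.of_associative_ring_bracket]

open Polynomial in
/-- The enveloping algebra of a two-dimensional Lie algebra with basis `a, b` and `[a, b] = s a` is
the Ore extension `k[a][b; id, -s a d/da]`. -/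
theorem isOreExtension_polynomial {s : k} (hs : ⁅B 0, B 1⁆ = s • B 0) :
    IsOreExtension (aeval (ι k (B 0)) : k[X] →ₐ[k] UniversalEnvelopingAlgebra k g) (ι k (B 1))
      (AlgHom.id k k[X]) ((-s) • (LinearMap.mulLeft k X ∘ₗ derivative)) := by
  set δ : k[X] →ₗ[k] k[X] := (-s) • (LinearMap.mulLeft k X ∘ₗ derivative)
  have hδX : δ X = -s • X := by simp [δ]
  have hleib : ∀ p q : k[X], δ (p * q) = AlgHom.id k k[X] p * δ q + δ p * q := by
    intro p q
    simp only [δ, LinearMap.smul_apply, LinearMap.comp_apply, LinearMap.mulLeft_apply,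
      derivative_mul, AlgHom.id_apply, smul_eq_C_mul]
    ring
  obtain ⟨O, _, _, ι₀, z₀, h₀⟩ := exists_isOreExtension (AlgHom.id k k[X]) δ hleib
  have hrel : ∀ p : k[X], ι k (B 1) * aeval (ι k (B 0)) p =
      aeval (ι k (B 0)) (AlgHom.id k k[X] p) * ι k (B 1) + aeval (ι k (B 0)) (δ p) := by
    intro p
    have hX : X ∈ oreRelSubalgebra hleib (aeval (ι k (B 0))) (ι k (B 1)) := by
      change ι k (B 1) * aeval (ι k (B 0)) X =
        aeval (ι k (B 0)) (AlgHom.id k k[X] X) * ι k (B 1) + aeval (ι k (B 0)) (δ X)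
      have h := ι_lie (k := k) (B 0) (B 1)
      rw [hs, map_smul] at h
      rw [hδX, map_smul, AlgHom.id_apply, aeval_X, neg_smul, h]
      abel
    have htop := Algebra.adjoin_le (Set.singleton_subset_iff.2 hX)
    rw [adjoin_X] at htop
    exact htop (Algebra.mem_top (x := p))
  let φ : g →ₗ[k] O := B.constr k ![ι₀ X, z₀]
  have hφ0 : φ (B 0) = ι₀ X := by simp [φ]
  have hφ1 : φ (B 1) = z₀ := by simp [φ]
  have hφ : φ ⁅B 0, B 1⁆ = ⁅φ (B 0), φ (B 1)⁆ := by
    rw [hs, map_smul, LieRing.of_associative_ring_bracket, hφ0, hφ1, h₀.rel, AlgHom.id_apply, hδX,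
      map_smul, neg_smul]
    abel
  let G := lift k (lieHomOfBasis B φ hφ)
  have hG : ∀ x, G (ι k x) = φ x := fun x => lift_ι_apply k _ x
  refine h₀.of_algHom hrel G ?_ (by rw [hG, hφ1]) ?_
  · intro p
    rw [← AlgHom.comp_apply]
    congr 1
    ext
    simp [-ι_apply, hG, hφ0]
  · intro S hS hz
    refine mem_of_ι_mem k S fun x => ?_
    rw [basis_expand B x, map_add, map_smul, map_smul]
    refine S.add_mem (S.smul_mem ?_ _) (S.smul_mem hz _)
    simpa [-ι_apply] using hS X

/-- The Poincaré–Birkhoff–Witt basis `aⁱ bʲ`. -/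
theorem exists_pbw_basis {s : k} (hs : ⁅B 0, B 1⁆ = s • B 0) :
    ∃ E : Module.Basis (ℕ × ℕ) k (UniversalEnvelopingAlgebra k g),
      ∀ i j, E (i, j) = ι k (B 0) ^ i * ι k (B 1) ^ j := by
  have h := isOreExtension_polynomial hs
  let e := LinearEquiv.ofBijective _ h.oreSum_bijective
  refine ⟨((Finsupp.basis fun _ : ℕ => Polynomial.basisMonomials k).map e).reindex
    ((Equiv.sigmaEquivProd ℕ ℕ).trans (Equiv.prodComm ℕ ℕ)), fun i j => ?_⟩
  rw [Module.Basis.reindex_apply, Module.Basis.map_apply]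
  have : (((Equiv.sigmaEquivProd ℕ ℕ).trans (Equiv.prodComm ℕ ℕ)).symm (i, j)) = ⟨j, i⟩ := rfl
  rw [this, Finsupp.coe_basis]
  change oreSum _ _ _ = _
  rw [oreSum_single, Polynomial.coe_basisMonomials, Polynomial.aeval_monomial, map_one, one_mul]

/-- The action of a linear functional on `U(𝔤)` through the coproduct: `u ↦ φ(u₁) u₂`. -/
noncomputable def hitLeft (φ : UniversalEnvelopingAlgebra k g →ₗ[k] k) :
    UniversalEnvelopingAlgebra k g →ₗ[k] UniversalEnvelopingAlgebra k g :=
  sliceLeft _ φ ∘ₗ Coalgebra.comul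

theorem hitLeft_apply (φ : UniversalEnvelopingAlgebra k g →ₗ[k] k)
    (u : UniversalEnvelopingAlgebra k g) :
    hitLeft φ u = sliceLeft _ φ (Coalgebra.comul u) := rfl

theorem hitLeft_counit (u : UniversalEnvelopingAlgebra k g) :
    hitLeft (Coalgebra.counit (R := k)) u = u :=
  sliceLeft_counit_comul u

theorem hitLeft_ι_mul (φ : UniversalEnvelopingAlgebra k g →ₗ[k] k) (x : g)
    (u : UniversalEnvelopingAlgebra k g) :
    hitLeft φ (ι k x * u) =
      hitLeft (φ ∘ₗ LinearMap.mulLeft k (ι k x)) u + ι k x * hitLeft φ u := by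
  rw [hitLeft_apply, hitLeft_apply, hitLeft_apply, Bialgebra.comul_mul, comul_ι]
  induction Coalgebra.comul (R := k) u using TensorProduct.induction_on with
  | zero => simp
  | add s t hs ht => simp only [mul_add, map_add, hs, ht]; abel
  | tmul p q =>
    simp [-ι_apply, add_mul, sliceLeft_tmul]

end TwoDimensionalLie

/-! ### Primitive and group-like elements of the enveloping algebra -/

section PoincareBirkhoffWitt

attribute [local instance 100] LieRing.ofAssociativeRing

open UniversalEnvelopingAlgebra

variable {k : Type u} [Field k] {g : Type v} [LieRing g] [LieAlgebra k g]
  {B : Module.Basis (Fin 2) k g} {s : k}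
  {E : Module.Basis (ℕ × ℕ) k (UniversalEnvelopingAlgebra k g)}

theorem coord_pbw (p q : ℕ × ℕ) : E.coord p (E q) = if q = p then 1 else 0 := by
  rw [Module.Basis.coord_apply, Module.Basis.repr_self, Finsupp.single_apply]

theorem fst_mul_pbw (hE : ∀ i j, E (i, j) = ι k (B 0) ^ i * ι k (B 1) ^ j) (i j : ℕ) :
    ι k (B 0) * E (i, j) = E (i + 1, j) := by
  rw [hE, hE, pow_succ', mul_assoc]

theorem snd_mul_pbw_zero (hE : ∀ i j, E (i, j) = ι k (B 0) ^ i * ι k (B 1) ^ j) (j : ℕ) :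
    ι k (B 1) * E (0, j) = E (0, j + 1) := by
  rw [hE, hE, pow_zero, one_mul, one_mul, pow_succ']

theorem snd_mul_pbw_succ (hs : ⁅B 0, B 1⁆ = s • B 0)
    (hE : ∀ i j, E (i, j) = ι k (B 0) ^ i * ι k (B 1) ^ j) (i j : ℕ) :
    ι k (B 1) * E (i + 1, j) = ι k (B 0) * (ι k (B 1) * E (i, j)) - s • E (i + 1, j) := by
  have h := ι_lie (k := k) (B 0) (B 1)
  rw [hs, map_smul] at h
  rw [← fst_mul_pbw hE, ← mul_assoc, ← mul_assoc, ← smul_mul_assoc, h, ← sub_mul, sub_sub_cancel]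

theorem coord_zero_zero (hE : ∀ i j, E (i, j) = ι k (B 0) ^ i * ι k (B 1) ^ j) :
    E.coord (0, 0) = Coalgebra.counit := by
  refine E.ext fun ⟨i, j⟩ => ?_
  rw [coord_pbw, hE, Bialgebra.counit_mul, Bialgebra.counit_pow, Bialgebra.counit_pow,
    counit_ι, counit_ι]
  rcases i with _ | i <;> rcases j with _ | j <;> simp

theorem coord_one_zero_fst_mul (hE : ∀ i j, E (i, j) = ι k (B 0) ^ i * ι k (B 1) ^ j) :
    E.coord (1, 0) ∘ₗ LinearMap.mulLeft k (ι k (B 0)) = E.coord (0, 0) := by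
  refine E.ext fun ⟨i, j⟩ => ?_
  rw [LinearMap.comp_apply, LinearMap.mulLeft_apply, fst_mul_pbw hE, coord_pbw, coord_pbw]
  simp

theorem coord_one_zero_snd_mul (hs : ⁅B 0, B 1⁆ = s • B 0)
    (hE : ∀ i j, E (i, j) = ι k (B 0) ^ i * ι k (B 1) ^ j) :
    E.coord (1, 0) ∘ₗ LinearMap.mulLeft k (ι k (B 1)) = (-s) • E.coord (1, 0) := by
  refine E.ext fun ⟨i, j⟩ => ?_
  rw [LinearMap.comp_apply, LinearMap.mulLeft_apply, LinearMap.smul_apply]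
  rcases i with _ | i
  · rw [snd_mul_pbw_zero hE, coord_pbw, coord_pbw]
    simp
  · have h := LinearMap.congr_fun (coord_one_zero_fst_mul hE) (ι k (B 1) * E (i, j))
    rw [LinearMap.comp_apply, LinearMap.mulLeft_apply, coord_zero_zero hE, Bialgebra.counit_mul,
      counit_ι, zero_mul] at h
    rw [snd_mul_pbw_succ hs hE, map_sub, h, map_smul, zero_sub, neg_smul]

theorem coord_zero_one_fst_mul (hE : ∀ i j, E (i, j) = ι k (B 0) ^ i * ι k (B 1) ^ j) :
    E.coord (0, 1) ∘ₗ LinearMap.mulLeft k (ι k (B 0)) = 0 := by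
  refine E.ext fun ⟨i, j⟩ => ?_
  rw [LinearMap.comp_apply, LinearMap.mulLeft_apply, fst_mul_pbw hE, coord_pbw]
  simp

theorem coord_zero_one_snd_mul (hs : ⁅B 0, B 1⁆ = s • B 0)
    (hE : ∀ i j, E (i, j) = ι k (B 0) ^ i * ι k (B 1) ^ j) :
    E.coord (0, 1) ∘ₗ LinearMap.mulLeft k (ι k (B 1)) = E.coord (0, 0) := by
  refine E.ext fun ⟨i, j⟩ => ?_
  rw [LinearMap.comp_apply, LinearMap.mulLeft_apply]
  rcases i with _ | i
  · rw [snd_mul_pbw_zero hE, coord_pbw, coord_pbw]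
    simp
  · have h := LinearMap.congr_fun (coord_zero_one_fst_mul hE) (ι k (B 1) * E (i, j))
    rw [LinearMap.comp_apply, LinearMap.mulLeft_apply, LinearMap.zero_apply] at h
    rw [snd_mul_pbw_succ hs hE, map_sub, h, map_smul, coord_pbw, coord_pbw]
    simp

theorem hitLeft_one (φ : UniversalEnvelopingAlgebra k g →ₗ[k] k) :
    hitLeft φ 1 = φ 1 • (1 : UniversalEnvelopingAlgebra k g) := by
  rw [hitLeft_apply, Bialgebra.comul_one, Algebra.TensorProduct.one_def, sliceLeft_tmul]

/-- The functional dual to `a` acts on `U(𝔤)` as `∂/∂a` in the basis `aⁱ bʲ`. -/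
theorem coord_hitLeft_one_zero (hs : ⁅B 0, B 1⁆ = s • B 0)
    (hE : ∀ i j, E (i, j) = ι k (B 0) ^ i * ι k (B 1) ^ j) (i j : ℕ)
    (u : UniversalEnvelopingAlgebra k g) :
    E.coord (i, j) (hitLeft (E.coord (1, 0)) u) = (i + 1 : k) * E.coord (i + 1, j) u := by
  have h0 : ∀ n, hitLeft (E.coord (1, 0)) (E (0, n)) = 0 := by
    intro n
    induction n with
    | zero =>
      have h1 : (1 : UniversalEnvelopingAlgebra k g) = E (0, 0) := by simp [hE]
      rw [← h1, hitLeft_one, h1, coord_pbw]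
      simp
    | succ n ih =>
      rw [← snd_mul_pbw_zero hE, hitLeft_ι_mul, coord_one_zero_snd_mul hs hE, ih, mul_zero,
        add_zero]
      have : hitLeft ((-s) • E.coord (1, 0)) (E (0, n)) =
          (-s) • hitLeft (E.coord (1, 0)) (E (0, n)) := by
        simp only [hitLeft_apply, sliceLeft, LinearMap.rTensor_smul, LinearMap.comp_apply,
          LinearMap.smul_apply, map_smul]
      rw [this, ih, smul_zero]
  have h1 : ∀ m n, hitLeft (E.coord (1, 0)) (E (m + 1, n)) = (m + 1 : k) • E (m, n) := by
    intro m n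
    induction m with
    | zero =>
      rw [← fst_mul_pbw hE, hitLeft_ι_mul, coord_one_zero_fst_mul hE, coord_zero_zero hE,
        hitLeft_counit, h0]
      simp
    | succ m ih =>
      rw [← fst_mul_pbw hE, hitLeft_ι_mul, coord_one_zero_fst_mul hE, coord_zero_zero hE,
        hitLeft_counit, ih, mul_smul_comm, fst_mul_pbw hE]
      push_cast
      module
  have key : E.coord (i, j) ∘ₗ hitLeft (E.coord (1, 0)) = (i + 1 : k) • E.coord (i + 1, j) := by
    refine E.ext fun ⟨m, n⟩ => ?_
    rw [LinearMap.comp_apply, LinearMap.smul_apply]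
    rcases m with _ | m
    · rw [h0, map_zero, coord_pbw]
      simp
    · rw [h1, map_smul, coord_pbw, coord_pbw]
      by_cases h : m = i ∧ n = j
      · simp [h.1, h.2]
      · simp [h]
  exact LinearMap.congr_fun key u

/-- The functional dual to `b` acts on `U(𝔤)` as `∂/∂b` in the basis `aⁱ bʲ`. -/
theorem coord_hitLeft_zero_one (hs : ⁅B 0, B 1⁆ = s • B 0)
    (hE : ∀ i j, E (i, j) = ι k (B 0) ^ i * ι k (B 1) ^ j) (i j : ℕ)
    (u : UniversalEnvelopingAlgebra k g) :
    E.coord (i, j) (hitLeft (E.coord (0, 1)) u) = (j + 1 : k) * E.coord (i, j + 1) u := by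
  have hz : hitLeft (0 : UniversalEnvelopingAlgebra k g →ₗ[k] k) = 0 := by
    ext u
    simp [hitLeft_apply, sliceLeft]
  have h0 : ∀ m, hitLeft (E.coord (0, 1)) (E (m, 0)) = 0 := by
    intro m
    induction m with
    | zero =>
      have h1 : (1 : UniversalEnvelopingAlgebra k g) = E (0, 0) := by simp [hE]
      rw [← h1, hitLeft_one, h1, coord_pbw]
      simp
    | succ m ih =>
      rw [← fst_mul_pbw hE, hitLeft_ι_mul, coord_zero_one_fst_mul hE, ih, mul_zero, hz]
      simp
  have h1 : ∀ m n, hitLeft (E.coord (0, 1)) (E (m, n + 1)) = (n + 1 : k) • E (m, n) := by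
    intro m n
    induction m with
    | zero =>
      induction n with
      | zero =>
        rw [← snd_mul_pbw_zero hE, hitLeft_ι_mul, coord_zero_one_snd_mul hs hE, coord_zero_zero hE,
          hitLeft_counit, h0]
        simp
      | succ n ih =>
        rw [← snd_mul_pbw_zero hE, hitLeft_ι_mul, coord_zero_one_snd_mul hs hE, coord_zero_zero hE,
          hitLeft_counit, ih, mul_smul_comm, snd_mul_pbw_zero hE]
        push_cast
        module
    | succ m ih =>
      rw [← fst_mul_pbw hE, hitLeft_ι_mul, coord_zero_one_fst_mul hE, ih, hz, mul_smul_comm,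
        fst_mul_pbw hE]
      simp
  have key : E.coord (i, j) ∘ₗ hitLeft (E.coord (0, 1)) = (j + 1 : k) • E.coord (i, j + 1) := by
    refine E.ext fun ⟨m, n⟩ => ?_
    rw [LinearMap.comp_apply, LinearMap.smul_apply]
    rcases n with _ | n
    · rw [h0, map_zero, coord_pbw]
      simp
    · rw [h1, map_smul, coord_pbw, coord_pbw]
      by_cases h : m = i ∧ n = j
      · simp [h.1, h.2]
      · simp [h]
  exact LinearMap.congr_fun key u

/-- An element of `U(𝔤)` annihilated by `∂/∂a` and `∂/∂b` is a scalar. -/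
theorem eq_smul_one_of_hitLeft_eq_zero [CharZero k] (hs : ⁅B 0, B 1⁆ = s • B 0)
    (hE : ∀ i j, E (i, j) = ι k (B 0) ^ i * ι k (B 1) ^ j) {u : UniversalEnvelopingAlgebra k g}
    (ha : hitLeft (E.coord (1, 0)) u = 0) (hb : hitLeft (E.coord (0, 1)) u = 0) :
    u = Coalgebra.counit (R := k) u • (1 : UniversalEnvelopingAlgebra k g) := by
  have h1 : (1 : UniversalEnvelopingAlgebra k g) = E (0, 0) := by simp [hE]
  refine E.ext_elem fun ⟨i, j⟩ => ?_
  rw [← Module.Basis.coord_apply, ← Module.Basis.coord_apply, map_smul]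
  rcases i with _ | i
  · rcases j with _ | j
    · rw [h1, coord_pbw, coord_zero_zero hE]
      simp
    · have h := coord_hitLeft_zero_one hs hE 0 j u
      rw [hb, map_zero, zero_eq_mul] at h
      rw [h.resolve_left (Nat.cast_add_one_ne_zero j), h1, coord_pbw]
      simp
  · have h := coord_hitLeft_one_zero hs hE i j u
    rw [ha, map_zero, zero_eq_mul] at h
    rw [h.resolve_left (Nat.cast_add_one_ne_zero i), h1, coord_pbw]
    simp

theorem exists_normalized_pbw_basis (hB : IsNormalizedBasis B) :
    ∃ (s : k) (E : Module.Basis (ℕ × ℕ) k (UniversalEnvelopingAlgebra k g)),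
      ⁅B 0, B 1⁆ = s • B 0 ∧ ∀ i j, E (i, j) = ι k (B 0) ^ i * ι k (B 1) ^ j := by
  obtain ⟨s, hs⟩ := hB.exists_lie_eq
  obtain ⟨E, hE⟩ := exists_pbw_basis hs
  exact ⟨s, E, hs, hE⟩

theorem IsNormalizedBasis.ι_injective (hB : IsNormalizedBasis B) :
    Function.Injective (ι k : g → UniversalEnvelopingAlgebra k g) := by
  obtain ⟨s, E, hs, hE⟩ := exists_normalized_pbw_basis hB
  have h0 : ι k (B 0) = E (1, 0) := by simp [-ι_apply, hE]
  have h1 : ι k (B 1) = E (0, 1) := by simp [-ι_apply, hE]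
  rw [injective_iff_map_eq_zero]
  intro x hx
  rw [basis_expand B x, map_add, map_smul, map_smul, h0, h1] at hx
  have e0 := congrArg (E.coord (1, 0)) hx
  have e1 := congrArg (E.coord (0, 1)) hx
  simp only [map_add, map_smul, coord_pbw, map_zero] at e0 e1
  rw [basis_expand B x]
  simp at e0 e1
  rw [e0, e1, zero_smul, zero_smul, add_zero]

/-- The functionals dual to `a` and `b`. -/
theorem IsNormalizedBasis.exists_dual (hB : IsNormalizedBasis B) :
    ∃ α β : UniversalEnvelopingAlgebra k g →ₗ[k] k, α (ι k (B 0)) = 1 ∧ α (ι k (B 1)) = 0 ∧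
      β (ι k (B 0)) = 0 ∧ β (ι k (B 1)) = 1 := by
  obtain ⟨s, E, hs, hE⟩ := exists_normalized_pbw_basis hB
  have h0 : ι k (B 0) = E (1, 0) := by simp [-ι_apply, hE]
  have h1 : ι k (B 1) = E (0, 1) := by simp [-ι_apply, hE]
  refine ⟨E.coord (1, 0), E.coord (0, 1), ?_⟩
  rw [h0, h1]
  simp only [coord_pbw]
  simp

/-- The only group-like element of `U(𝔤)` is `1`: on a group-like element the locally nilpotent
operators `∂/∂a` and `∂/∂b` act as scalars, which must vanish. -/
theorem IsNormalizedBasis.eq_one_of_isGroupLike [CharZero k] (hB : IsNormalizedBasis B)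
    {r : UniversalEnvelopingAlgebra k g} (hr : Coalgebra.comul (R := k) r = r ⊗ₜ r)
    (hr1 : Coalgebra.counit (R := k) r = 1) : r = 1 := by
  obtain ⟨s, E, hs, hE⟩ := exists_normalized_pbw_basis hB
  have hit : ∀ φ : UniversalEnvelopingAlgebra k g →ₗ[k] k, hitLeft φ r = φ r • r := by
    intro φ
    rw [hitLeft_apply, hr, sliceLeft_tmul]
  have h00 : E.coord (0, 0) r = 1 := by rw [coord_zero_zero hE, hr1]
  have ha : E.coord (1, 0) r = 0 := by
    -- otherwise all coefficients of powers of `a` would be nonzero, as `∂/∂a` scales `r`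
    by_contra hne
    have : ∀ i : ℕ, E.coord (i, 0) r ≠ 0 := by
      intro i
      induction i with
      | zero => rw [h00]; exact one_ne_zero
      | succ i ih =>
        have h := coord_hitLeft_one_zero hs hE i 0 r
        rw [hit, map_smul, smul_eq_mul] at h
        intro h'
        rw [h', mul_zero] at h
        exact (mul_ne_zero hne ih) h
    refine Set.infinite_of_injective_forall_mem (f := fun i : ℕ => (i, 0))
      (fun i j h => (Prod.ext_iff.1 h).1) (fun i => ?_) (E.repr r).support.finite_toSet
    simpa using this i
  have hb : E.coord (0, 1) r = 0 := by
    by_contra hne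
    -- the same for powers of `b`
    have : ∀ i : ℕ, E.coord (0, i) r ≠ 0 := by
      intro i
      induction i with
      | zero => rw [h00]; exact one_ne_zero
      | succ i ih =>
        have h := coord_hitLeft_zero_one hs hE 0 i r
        rw [hit, map_smul, smul_eq_mul] at h
        intro h'
        rw [h', mul_zero] at h
        exact (mul_ne_zero hne ih) h
    refine Set.infinite_of_injective_forall_mem (f := fun i : ℕ => (0, i))
      (fun i j h => (Prod.ext_iff.1 h).2) (fun i => ?_) (E.repr r).support.finite_toSet
    simpa using this i
  have h := eq_smul_one_of_hitLeft_eq_zero hs hE (u := r) (by rw [hit, ha, zero_smul])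
    (by rw [hit, hb, zero_smul])
  rwa [hr1, one_smul] at h

/-- The primitive elements of `U(𝔤)` are the elements of `𝔤`. -/
theorem IsNormalizedBasis.exists_eq_ι_of_primitive [CharZero k] (hB : IsNormalizedBasis B)
    {x : UniversalEnvelopingAlgebra k g} (hx : Coalgebra.comul (R := k) x = x ⊗ₜ 1 + 1 ⊗ₜ x) :
    ∃ v : g, x = ι k v := by
  obtain ⟨s, E, hs, hE⟩ := exists_normalized_pbw_basis hB
  have hprim : ∀ (φ : UniversalEnvelopingAlgebra k g →ₗ[k] k) (u), φ 1 = 0 →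
      Coalgebra.comul (R := k) u = u ⊗ₜ 1 + 1 ⊗ₜ u → hitLeft φ u = φ u • 1 := by
    intro φ u h1 hu
    rw [hitLeft_apply, hu, map_add, sliceLeft_tmul, sliceLeft_tmul, h1, zero_smul, add_zero]
  have h1 : (1 : UniversalEnvelopingAlgebra k g) = E (0, 0) := by simp [hE]
  have h0 : ι k (B 0) = E (1, 0) := by simp [-ι_apply, hE]
  have h2 : ι k (B 1) = E (0, 1) := by simp [-ι_apply, hE]
  have ha1 : E.coord (1, 0) 1 = 0 := by rw [h1, coord_pbw]; simp
  have hb1 : E.coord (0, 1) 1 = 0 := by rw [h1, coord_pbw]; simp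
  set v : g := E.coord (1, 0) x • B 0 + E.coord (0, 1) x • B 1 with hv
  have hva : E.coord (1, 0) (ι k v) = E.coord (1, 0) x := by
    rw [hv, map_add, map_smul, map_smul, h0, h2, map_add, map_smul, map_smul, coord_pbw, coord_pbw]
    simp
  have hvb : E.coord (0, 1) (ι k v) = E.coord (0, 1) x := by
    rw [hv, map_add, map_smul, map_smul, h0, h2, map_add, map_smul, map_smul, coord_pbw, coord_pbw]
    simp
  refine ⟨v, ?_⟩
  have h := eq_smul_one_of_hitLeft_eq_zero hs hE (u := x - ι k v)
    (by rw [map_sub, hprim _ x ha1 hx, hprim _ _ ha1 (comul_ι k v), hva, sub_self])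
    (by rw [map_sub, hprim _ x hb1 hx, hprim _ _ hb1 (comul_ι k v), hvb, sub_self])
  rw [map_sub, counit_eq_zero_of_primitive hx, counit_ι, sub_zero, zero_smul] at h
  exact sub_eq_zero.1 h

end PoincareBirkhoffWitt

/-! ### Hopf algebras from generators, and twisted derivations -/

section HopfCriterion

variable {k : Type u} [Field k] {H : Type w} [Ring H] [Bialgebra k H]

/-- The convolution `h ↦ S(h₁) h₂` on tensors. -/
noncomputable def convLeft (S : H →ₐ[k] Hᵐᵒᵖ) : H ⊗[k] H →ₗ[k] H :=
  LinearMap.mul' k H ∘ₗ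
    ((MulOpposite.opLinearEquiv k).symm.toLinearMap ∘ₗ S.toLinearMap).rTensor H

/-- The convolution `h ↦ h₁ S(h₂)` on tensors. -/
noncomputable def convRight (S : H →ₐ[k] Hᵐᵒᵖ) : H ⊗[k] H →ₗ[k] H :=
  LinearMap.mul' k H ∘ₗ
    ((MulOpposite.opLinearEquiv k).symm.toLinearMap ∘ₗ S.toLinearMap).lTensor H

theorem convLeft_tmul (S : H →ₐ[k] Hᵐᵒᵖ) (p q : H) :
    convLeft S (p ⊗ₜ q) = (S p).unop * q := rfl

theorem convRight_tmul (S : H →ₐ[k] Hᵐᵒᵖ) (p q : H) :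
    convRight S (p ⊗ₜ q) = p * (S q).unop := rfl

theorem convLeft_mul_tmul (S : H →ₐ[k] Hᵐᵒᵖ) (t : H ⊗[k] H) (p q : H) :
    convLeft S (t * p ⊗ₜ q) = (S p).unop * convLeft S t * q := by
  induction t using TensorProduct.induction_on with
  | zero => simp
  | add s t hs ht => rw [add_mul, map_add, hs, ht, map_add, mul_add, add_mul]
  | tmul a b =>
    rw [Algebra.TensorProduct.tmul_mul_tmul, convLeft_tmul, convLeft_tmul, map_mul,
      MulOpposite.unop_mul]
    simp only [mul_assoc]

theorem convRight_tmul_mul (S : H →ₐ[k] Hᵐᵒᵖ) (t : H ⊗[k] H) (p q : H) :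
    convRight S (p ⊗ₜ q * t) = p * convRight S t * (S q).unop := by
  induction t using TensorProduct.induction_on with
  | zero => simp
  | add s t hs ht => rw [mul_add, map_add, hs, ht, map_add, mul_add, add_mul]
  | tmul a b =>
    rw [Algebra.TensorProduct.tmul_mul_tmul, convRight_tmul, convRight_tmul, map_mul,
      MulOpposite.unop_mul]
    simp only [mul_assoc]

/-- An algebra antimorphism `S` of a bialgebra is an antipode if the antipode axioms hold on algebra
generators. -/
@[reducible]
noncomputable def hopfAlgebraOfGenerators (S : H →ₐ[k] Hᵐᵒᵖ) (s : Set H)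
    (hs : Algebra.adjoin k s = ⊤)
    (hl : ∀ x ∈ s, convLeft S (Coalgebra.comul x) = Coalgebra.counit (R := k) x • 1)
    (hr : ∀ x ∈ s, convRight S (Coalgebra.comul x) = Coalgebra.counit (R := k) x • 1) :
    HopfAlgebra k H where
  antipode := (MulOpposite.opLinearEquiv k).symm.toLinearMap ∘ₗ S.toLinearMap
  mul_antipode_rTensor_comul := by
    -- the stronger statement with a factor `t` is inherited by products
    let T : Subalgebra k H :=
      { carrier := {h | ∀ t, convLeft S (Coalgebra.comul h * t) =
          Coalgebra.counit (R := k) h • convLeft S t}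
        mul_mem' := by
          intro a b ha hb t
          rw [Bialgebra.comul_mul, mul_assoc, ha, hb, Bialgebra.counit_mul, smul_smul]
        add_mem' := by
          intro a b ha hb t
          rw [map_add, add_mul, map_add, ha, hb, map_add, add_smul]
        algebraMap_mem' := by
          intro r t
          rw [Bialgebra.comul_algebraMap, Bialgebra.counit_algebraMap, ← Algebra.smul_def,
            map_smul] }
    have hT : ∀ x, x ∈ T := by
      intro x
      have hle : Algebra.adjoin k s ≤ T := by
        refine Algebra.adjoin_le fun x hx t => ?_
        induction t using TensorProduct.induction_on with
        | zero => simp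
        | add s t hs ht => rw [mul_add, map_add, hs, ht, map_add, smul_add]
        | tmul p q => rw [convLeft_mul_tmul, hl x hx, convLeft_tmul]; simp
      rw [hs] at hle
      exact hle Algebra.mem_top
    ext x
    have h := hT x (1 ⊗ₜ 1)
    rw [← Algebra.TensorProduct.one_def, mul_one, Algebra.TensorProduct.one_def, convLeft_tmul,
      map_one, MulOpposite.unop_one, mul_one] at h
    exact h.trans (Algebra.algebraMap_eq_smul_one _).symm
  mul_antipode_lTensor_comul := by
    let T : Subalgebra k H :=
      { carrier := {h | ∀ t, convRight S (t * Coalgebra.comul h) =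
          Coalgebra.counit (R := k) h • convRight S t}
        mul_mem' := by
          intro a b ha hb t
          rw [Bialgebra.comul_mul, ← mul_assoc, hb, ha, Bialgebra.counit_mul, smul_smul, mul_comm]
        add_mem' := by
          intro a b ha hb t
          rw [map_add, mul_add, map_add, ha, hb, map_add, add_smul]
        algebraMap_mem' := by
          intro r t
          rw [Bialgebra.comul_algebraMap, Bialgebra.counit_algebraMap, ← Algebra.commutes,
            ← Algebra.smul_def, map_smul] }
    have hT : ∀ x, x ∈ T := by
      intro x
      have hle : Algebra.adjoin k s ≤ T := by
        refine Algebra.adjoin_le fun x hx t => ?_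
        induction t using TensorProduct.induction_on with
        | zero => simp
        | add s t hs ht => rw [add_mul, map_add, hs, ht, map_add, smul_add]
        | tmul p q => rw [convRight_tmul_mul, hr x hx, convRight_tmul]; simp
      rw [hs] at hle
      exact hle Algebra.mem_top
    ext x
    have h := hT x (1 ⊗ₜ 1)
    rw [← Algebra.TensorProduct.one_def, one_mul, Algebra.TensorProduct.one_def, convRight_tmul,
      map_one, MulOpposite.unop_one, mul_one] at h
    exact h.trans (Algebra.algebraMap_eq_smul_one _).symm

end HopfCriterion

section TwistData

attribute [local instance 100] LieRing.ofAssociativeRing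

open UniversalEnvelopingAlgebra

variable {k : Type u} [Field k] {g : Type v} [LieRing g] [LieAlgebra k g]

/-- If `[𝔤, 𝔤] ≠ 0`, it is spanned by one vector `a`, and some `b` satisfies `[a, b] = a`. -/
theorem exists_isNormalizedBasis (hg : Module.finrank k g = 2) :
    ∃ B : Module.Basis (Fin 2) k g, IsNormalizedBasis B := by
  have : Module.Finite k g := Module.finite_of_finrank_pos (by omega)
  let B := Module.finBasisOfFinrankEq k g hg
  by_cases h0 : ⁅B 0, B 1⁆ = 0
  · exact ⟨B, Or.inl h0⟩
  obtain ⟨b, hb⟩ : ∃ b : g, ⁅⁅B 0, B 1⁆, b⁆ = ⁅B 0, B 1⁆ := by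
    have hexp := basis_expand B ⁅B 0, B 1⁆
    set p := B.repr ⁅B 0, B 1⁆ 0
    set q := B.repr ⁅B 0, B 1⁆ 1
    by_cases hp : p = 0
    · have hq : q ≠ 0 := by
        intro hq
        rw [hp, hq, zero_smul, zero_smul, add_zero] at hexp
        exact h0 hexp
      rw [hp, zero_smul, zero_add] at hexp
      refine ⟨-q⁻¹ • B 0, ?_⟩
      conv_lhs => rw [hexp]
      rw [lie_smul, smul_lie, smul_smul, ← lie_skew, smul_neg, neg_mul, inv_mul_cancel₀ hq,
        neg_one_smul, neg_neg]
    · refine ⟨p⁻¹ • B 1, ?_⟩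
      conv_lhs => rw [hexp]
      rw [lie_smul, add_lie, smul_lie, smul_lie, lie_self, smul_zero, add_zero, smul_smul,
        inv_mul_cancel₀ hp, one_smul]
  set a := ⁅B 0, B 1⁆
  have hli : LinearIndependent k ![a, b] := by
    rw [LinearIndependent.pair_iff]
    intro s t hst
    have h1 := congrArg (fun x => ⁅a, x⁆) hst
    simp only [lie_add, lie_smul, lie_self, smul_zero, zero_add, hb, lie_zero] at h1
    have ht : t = 0 := (smul_eq_zero.1 h1).resolve_right h0
    rw [ht, zero_smul, add_zero] at hst
    exact ⟨(smul_eq_zero.1 hst).resolve_right h0, ht⟩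
  refine ⟨basisOfLinearIndependentOfCardEqFinrank hli (by simp [hg]), Or.inr ?_⟩
  simpa using hb

theorem mem_of_ι_basis_mem (B : Module.Basis (Fin 2) k g)
    (S : Subalgebra k (UniversalEnvelopingAlgebra k g)) (h : ∀ i, ι k (B i) ∈ S)
    (a : UniversalEnvelopingAlgebra k g) : a ∈ S := by
  refine mem_of_ι_mem k S (fun x => ?_) a
  rw [basis_expand B x, map_add, map_smul, map_smul]
  exact S.add_mem (S.smul_mem (h 0) _) (S.smul_mem (h 1) _)

/-- A twisted derivation of `U(𝔤)` can be prescribed on `𝔤`, provided it is compatible with the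
relation between the basis vectors: `δ` is the corner of the morphism to upper triangular matrices
`u ↦ !![τ(u), δ(u); 0, u]`. -/
theorem exists_twistedDerivation (B : Module.Basis (Fin 2) k g)
    (τ : UniversalEnvelopingAlgebra k g →ₐ[k] UniversalEnvelopingAlgebra k g)
    (D : g →ₗ[k] UniversalEnvelopingAlgebra k g)
    (h : D ⁅B 0, B 1⁆ = τ (ι k (B 0)) * D (B 1) + D (B 0) * ι k (B 1) -
      τ (ι k (B 1)) * D (B 0) - D (B 1) * ι k (B 0)) :
    ∃ δ : UniversalEnvelopingAlgebra k g →ₗ[k] UniversalEnvelopingAlgebra k g,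
      (∀ a b, δ (a * b) = τ a * δ b + δ a * b) ∧ ∀ x, δ (ι k x) = D x := by
  let φ : g →ₗ[k] Matrix (Fin 2) (Fin 2) (UniversalEnvelopingAlgebra k g) :=
    { toFun := fun x => !![τ (ι k x), D x; 0, ι k x]
      map_add' := by
        intro x y
        ext i j
        fin_cases i <;> fin_cases j <;> simp [-ι_apply]
      map_smul' := by
        intro r x
        ext i j
        fin_cases i <;> fin_cases j <;> simp [-ι_apply] }
  have hφ : ∀ x, φ x = !![τ (ι k x), D x; 0, ι k x] := fun x => rfl
  have hφB : φ ⁅B 0, B 1⁆ = ⁅φ (B 0), φ (B 1)⁆ := by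
    rw [LieRing.of_associative_ring_bracket, hφ, hφ, hφ, h, ι_lie, map_sub, map_mul, map_mul]
    ext i j
    fin_cases i <;> fin_cases j <;> simp [-ι_apply]
    abel
  let F := lift k (lieHomOfBasis B φ hφB)
  have hF : ∀ x, F (ι k x) = φ x := fun x => lift_ι_apply k _ x
  let S : Subalgebra k (UniversalEnvelopingAlgebra k g) :=
    { carrier := {a | F a 0 0 = τ a ∧ F a 1 0 = 0 ∧ F a 1 1 = a}
      mul_mem' := by
        rintro a b ⟨h1, h2, h3⟩ ⟨h4, h5, h6⟩
        simp only [Set.mem_ofPred_eq, map_mul, Matrix.mul_apply, Fin.sum_univ_two, h1, h2, h3, h4,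
          h5, h6]
        simp
      add_mem' := by
        rintro a b ⟨h1, h2, h3⟩ ⟨h4, h5, h6⟩
        simp only [Set.mem_ofPred_eq, map_add, Matrix.add_apply, h1, h2, h3, h4, h5, h6]
        simp
      algebraMap_mem' := by
        intro r
        simp only [Set.mem_ofPred_eq, AlgHom.commutes, Matrix.algebraMap_matrix_apply]
        simp }
  have hS : ∀ a, a ∈ S := mem_of_ι_mem k S fun x => by
    change F (ι k x) 0 0 = _ ∧ F (ι k x) 1 0 = _ ∧ F (ι k x) 1 1 = _
    rw [hF, hφ]
    simp
  refine ⟨{ toFun := fun a => F a 0 1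
            map_add' := fun a b => by rw [map_add, Matrix.add_apply]
            map_smul' := fun r a => by rw [map_smul, Matrix.smul_apply]; rfl }, fun a b => ?_,
    fun x => ?_⟩
  · change F (a * b) 0 1 = τ a * F b 0 1 + F a 0 1 * b
    rw [map_mul, Matrix.mul_apply, Fin.sum_univ_two, (hS a).1, (hS b).2.2]
  · change F (ι k x) 0 1 = D x
    rw [hF, hφ]
    simp

/-- The left winding automorphism `x ↦ x + χ(x)` of `U(𝔤)` defined by a character of `𝔤`. -/
noncomputable def winding (χ : LieAlgebra.LieCharacter k g) :
    UniversalEnvelopingAlgebra k g →ₐ[k] UniversalEnvelopingAlgebra k g :=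
  lift k
    { toFun := fun x => ι k x + χ x • 1
      map_add' := fun x y => by rw [map_add, map_add, add_smul]; abel
      map_smul' := fun r x => by
        rw [map_smul, map_smul, RingHom.id_apply, smul_add, smul_eq_mul, mul_smul]
      map_lie' := fun {x y} => by
        rw [LieAlgebra.lieCharacter_apply_lie, ι_lie, LieRing.of_associative_ring_bracket]
        simp only [add_mul, mul_add, smul_mul_assoc, mul_smul_comm, one_mul, mul_one]
        module }

theorem winding_ι (χ : LieAlgebra.LieCharacter k g) (x : g) :
    winding χ (ι k x) = ι k x + χ x • 1 := by
  rw [winding, lift_ι_apply]; rfl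

/-- The winding automorphism is the twist `u ↦ χ(u₁) u₂`. -/
theorem winding_eq_twistedAd (χ : LieAlgebra.LieCharacter k g)
    (a : UniversalEnvelopingAlgebra k g) : winding χ a = twistedAd (lift k χ) 1 a := by
  let ψ : UniversalEnvelopingAlgebra k g →ₐ[k] UniversalEnvelopingAlgebra k g :=
    (Algebra.TensorProduct.lid k _).toAlgHom.comp
      ((Algebra.TensorProduct.map (lift k χ) (AlgHom.id k _)).comp (Bialgebra.comulAlgHom k _))
  have hψ : winding χ = ψ := algHom_eq fun x => by
    simp only [ψ, AlgHom.comp_apply, Bialgebra.comulAlgHom_apply, comul_ι, map_add,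
      Algebra.TensorProduct.map_tmul, winding_ι, lift_ι_apply]
    simp [-ι_apply, add_comm]
  rw [hψ, twistedAd, HopfAlgebra.antipode_one, one_mul, mul_one]
  rfl

end TwistData

/-! ### Hopf algebra structures on Ore extensions -/

section HopfStructure

attribute [local instance 100] LieRing.ofAssociativeRing

open UniversalEnvelopingAlgebra

variable {k : Type u} [Field k] {g : Type v} [LieRing g] [LieAlgebra k g]
  {B : Module.Basis (Fin 2) k g}

theorem antipode_ι (x : g) : HopfAlgebra.antipode k (ι k x) = -ι k x := by
  change (antipodeHom k g (ι k x)).unop = _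
  rw [antipodeHom_ι]
  rfl

namespace IsOreExtension

section

variable {H : Type w} [Ring H] [Algebra k H]
  {ι' : UniversalEnvelopingAlgebra k g →ₐ[k] H} {z : H}
  {τ : UniversalEnvelopingAlgebra k g →ₐ[k] UniversalEnvelopingAlgebra k g}
  {δ : UniversalEnvelopingAlgebra k g →ₗ[k] UniversalEnvelopingAlgebra k g}

theorem algHom_ext_of_basis (h : IsOreExtension ι' z τ δ) (B : Module.Basis (Fin 2) k g)
    {R : Type*} [Ring R] [Algebra k R] {F G : H →ₐ[k] R}
    (hι : ∀ i, F (ι' (ι k (B i))) = G (ι' (ι k (B i)))) (hz : F z = G z) : F = G :=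
  h.algHom_ext (fun a => mem_of_ι_basis_mem B (AlgHom.equalizer (F.comp ι') (G.comp ι')) hι a) hz

theorem exists_algHom_of_basis (h : IsOreExtension ι' z τ δ) (B : Module.Basis (Fin 2) k g)
    {R : Type*} [Ring R] [Algebra k R] (f : UniversalEnvelopingAlgebra k g →ₐ[k] R) (Z : R)
    (hrel : ∀ i, Z * f (ι k (B i)) = f (τ (ι k (B i))) * Z + f (δ (ι k (B i)))) :
    ∃ F : H →ₐ[k] R, (∀ a, F (ι' a) = f a) ∧ F z = Z :=
  h.exists_algHom f Z fun a =>
    mem_of_ι_basis_mem B (oreRelSubalgebra h.leibniz f Z) hrel a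

theorem adjoin_eq_top (h : IsOreExtension ι' z τ δ) (B : Module.Basis (Fin 2) k g) :
    Algebra.adjoin k (insert z (Set.range fun i => ι' (ι k (B i)))) = ⊤ := by
  refine Algebra.eq_top_iff.2 (h.mem_of_mem _ (fun a => ?_) ?_)
  · refine mem_of_ι_basis_mem B ((Algebra.adjoin k _).comap ι') (fun i => ?_) a
    exact Algebra.subset_adjoin (Set.mem_insert_of_mem _ ⟨i, rfl⟩)
  · exact Algebra.subset_adjoin (Set.mem_insert _ _)

end

/-- An Ore extension of `U(𝔤)` that is a bialgebra with the expected values of the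
comultiplication and the counit on generators is a Hopf algebra: the antipode has
`S(z) = -z + xy`. -/
theorem exists_isGeneralizedHopfOre_of_bialgebra {H : Type w} [Ring H] [Bialgebra k H]
    {ι' : UniversalEnvelopingAlgebra k g →ₐ[k] H} {z : H}
    {τ : UniversalEnvelopingAlgebra k g →ₐ[k] UniversalEnvelopingAlgebra k g}
    {δ : UniversalEnvelopingAlgebra k g →ₗ[k] UniversalEnvelopingAlgebra k g}
    {χ : g → k} {v w : g} (h : IsOreExtension ι' z τ δ)
    (hcomul : ∀ i, Coalgebra.comul (R := k) (ι' (ι k (B i))) =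
      ι' (ι k (B i)) ⊗ₜ[k] 1 + 1 ⊗ₜ[k] ι' (ι k (B i)))
    (hcounit : ∀ i, Coalgebra.counit (R := k) (ι' (ι k (B i))) = 0)
    (hcomulz : Coalgebra.comul (R := k) z =
      z ⊗ₜ[k] 1 + ι' (ι k v) ⊗ₜ[k] ι' (ι k w) + 1 ⊗ₜ[k] z)
    (hcounitz : Coalgebra.counit (R := k) z = 0)
    (hτ : ∀ i, τ (ι k (B i)) = ι k (B i) + χ (B i) • 1)
    (hS : ∀ i, δ (ι k (B i)) + HopfAlgebra.antipode k (δ (ι k (B i))) =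
      ι k v * ι k w * ι k (B i) - ι k (B i) * (ι k v * ι k w) - χ (B i) • (ι k v * ι k w)) :
    ∃ (H' : Type w) (_ : Ring H') (_ : HopfAlgebra k H')
      (ι'' : UniversalEnvelopingAlgebra k g →ₐc[k] H') (z' : H'),
      IsGeneralizedHopfOre ι'' z' τ δ 1 1 (ι k v) (ι k w) := by
  let f : UniversalEnvelopingAlgebra k g →ₐ[k] Hᵐᵒᵖ := (AlgHom.op ι').comp (antipodeHom k g)
  have hfS : ∀ a, f a = MulOpposite.op (ι' (HopfAlgebra.antipode k a)) := fun a => rfl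
  obtain ⟨S, hSa, hSz⟩ := h.exists_algHom_of_basis B f
    (MulOpposite.op (-z + ι' (ι k v * ι k w))) (by
      intro i
      rw [hτ, map_add, map_smul, map_one, hfS, hfS, antipode_ι, eq_sub_iff_add_eq'.2 (hS i)]
      apply MulOpposite.unop_injective
      simp only [MulOpposite.unop_mul, MulOpposite.unop_add, MulOpposite.unop_smul,
        MulOpposite.unop_op, MulOpposite.unop_one, map_neg, map_sub, map_mul, map_smul]
      have hr := h.rel (ι k (B i))
      rw [hτ, map_add, map_smul, map_one, add_mul, smul_mul_assoc, one_mul] at hr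
      simp only [neg_mul, mul_neg, mul_add, add_mul, mul_one, mul_smul_comm, hr]
      simp only [smul_add, smul_neg, mul_assoc]
      abel)
  have hcounit' : (Bialgebra.counitAlgHom k H).comp ι' = Bialgebra.counitAlgHom k _ :=
    AlgHom.ext fun a => mem_of_ι_basis_mem B
      (AlgHom.equalizer ((Bialgebra.counitAlgHom k H).comp ι') (Bialgebra.counitAlgHom k _))
      (fun i => by
        rw [AlgHom.mem_equalizer, AlgHom.comp_apply, Bialgebra.counitAlgHom_apply,
          Bialgebra.counitAlgHom_apply, hcounit, counit_ι]) a
  have hcomul' : (Algebra.TensorProduct.map ι' ι').comp (Bialgebra.comulAlgHom k _) =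
      (Bialgebra.comulAlgHom k H).comp ι' :=
    AlgHom.ext fun a => mem_of_ι_basis_mem B
      (AlgHom.equalizer ((Algebra.TensorProduct.map ι' ι').comp (Bialgebra.comulAlgHom k _))
        ((Bialgebra.comulAlgHom k H).comp ι'))
      (fun i => by
        rw [AlgHom.mem_equalizer, AlgHom.comp_apply, AlgHom.comp_apply,
          Bialgebra.comulAlgHom_apply, Bialgebra.comulAlgHom_apply, hcomul, comul_ι, map_add,
          Algebra.TensorProduct.map_tmul, Algebra.TensorProduct.map_tmul, map_one]) a
  have hSι' : ∀ x : g, S (ι' (ι k x)) = MulOpposite.op (-ι' (ι k x)) := by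
    intro x
    rw [hSa, hfS, antipode_ι, map_neg]
  have hl : ∀ x ∈ insert z (Set.range fun i => ι' (ι k (B i))),
      convLeft S (Coalgebra.comul x) = Coalgebra.counit (R := k) x • 1 := by
    rintro x (rfl | ⟨i, rfl⟩)
    · rw [hcomulz, map_add, map_add, convLeft_tmul, convLeft_tmul, convLeft_tmul, hSz, hSι',
        hcounitz, map_mul]
      simp [-ι_apply]
    · dsimp only
      rw [hcomul, map_add, convLeft_tmul, convLeft_tmul, hSι', hcounit]
      simp [-ι_apply]
  have hr : ∀ x ∈ insert z (Set.range fun i => ι' (ι k (B i))),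
      convRight S (Coalgebra.comul x) = Coalgebra.counit (R := k) x • 1 := by
    rintro x (rfl | ⟨i, rfl⟩)
    · rw [hcomulz, map_add, map_add, convRight_tmul, convRight_tmul, convRight_tmul, hSz, hSι',
        hcounitz, map_mul]
      simp only [MulOpposite.unop_op, map_one, MulOpposite.unop_one, mul_one, one_mul, mul_neg,
        zero_smul]
      abel
    · dsimp only
      rw [hcomul, map_add, convRight_tmul, convRight_tmul, hSι', hcounit]
      simp [-ι_apply]
  let hopf : HopfAlgebra k H := hopfAlgebraOfGenerators S _ (h.adjoin_eq_top B) hl hr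
  refine ⟨H, _, hopf, BialgHom.ofAlgHom ι' hcounit' hcomul', z, h, ?_⟩
  rw [hcomulz]
  change _ = z ⊗ₜ[k] ι' 1 + ι' (ι k v) ⊗ₜ[k] ι' (ι k w) + ι' 1 ⊗ₜ[k] z
  rw [map_one]

end IsOreExtension

/-- Existence of the generalized Hopf-Ore extension of `U(𝔤)` with
`Δ z = z ⊗ 1 + x ⊗ y + 1 ⊗ z`, where `x, y ∈ 𝔤`. On each basis vector `u`, the condition `hcomul`
makes `Δ` compatible with the relation `z u = τ(u) z + δ(u)`, `hcounit` does the same for the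
counit, and `hS` for the antipode `z ↦ -z + xy`. -/
theorem exists_isGeneralizedHopfOre {χ : g → k} {v w : g}
    {τ : UniversalEnvelopingAlgebra k g →ₐ[k] UniversalEnvelopingAlgebra k g}
    {δ : UniversalEnvelopingAlgebra k g →ₗ[k] UniversalEnvelopingAlgebra k g}
    (hτ : ∀ i, τ (ι k (B i)) = ι k (B i) + χ (B i) • 1)
    (hδ : ∀ a b, δ (a * b) = τ a * δ b + δ a * b)
    (hcomul : ∀ i, Coalgebra.comul (R := k) (δ (ι k (B i))) =
      δ (ι k (B i)) ⊗ₜ[k] 1 + 1 ⊗ₜ[k] δ (ι k (B i)) +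
      ι k v ⊗ₜ[k] ι k w * (ι k (B i) ⊗ₜ[k] 1 + 1 ⊗ₜ[k] ι k (B i)) -
      (ι k (B i) ⊗ₜ[k] 1 + 1 ⊗ₜ[k] ι k (B i)) * ι k v ⊗ₜ[k] ι k w -
      χ (B i) • ι k v ⊗ₜ[k] ι k w)
    (hcounit : ∀ i, Coalgebra.counit (R := k) (δ (ι k (B i))) = 0)
    (hS : ∀ i, δ (ι k (B i)) + HopfAlgebra.antipode k (δ (ι k (B i))) =
      ι k v * ι k w * ι k (B i) - ι k (B i) * (ι k v * ι k w) - χ (B i) • (ι k v * ι k w)) :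
    ∃ (H : Type (max u v)) (_ : Ring H) (_ : HopfAlgebra k H)
      (ι' : UniversalEnvelopingAlgebra k g →ₐc[k] H) (z : H),
      IsGeneralizedHopfOre ι' z τ δ 1 1 (ι k v) (ι k w) := by
  obtain ⟨O, _, _, ι₀, z, h⟩ := exists_isOreExtension τ δ hδ
  let ιι := Algebra.TensorProduct.map ι₀ ι₀
  obtain ⟨Δ, hΔι, hΔz⟩ := h.exists_algHom_of_basis B
    (ιι.comp (Bialgebra.comulAlgHom k _))
    (z ⊗ₜ[k] 1 + ι₀ (ι k v) ⊗ₜ[k] ι₀ (ι k w) + 1 ⊗ₜ[k] z) (by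
      intro i
      have hr := h.rel (ι k (B i))
      rw [hτ, map_add, map_smul, map_one, add_mul, smul_mul_assoc, one_mul] at hr
      rw [hτ, map_add, map_smul, map_one, AlgHom.comp_apply, AlgHom.comp_apply,
        Bialgebra.comulAlgHom_apply, Bialgebra.comulAlgHom_apply, hcomul, comul_ι]
      simp only [ιι, map_add, map_sub, map_smul, map_mul, Algebra.TensorProduct.map_tmul, map_one,
        mul_add, add_mul, Algebra.TensorProduct.tmul_mul_tmul, one_mul, mul_one, hr,
        TensorProduct.add_tmul, TensorProduct.tmul_add, smul_mul_assoc,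
        TensorProduct.tmul_smul, ← TensorProduct.smul_tmul']
      module)
  obtain ⟨ε, hει, hεz⟩ := h.exists_algHom_of_basis B (Bialgebra.counitAlgHom k _) 0 (by
      intro i
      simp only [Bialgebra.counitAlgHom_apply]
      rw [hcounit, zero_mul, mul_zero, zero_add])
  have hΔB : ∀ x, Δ (ι₀ (ι k x)) = ι₀ (ι k x) ⊗ₜ[k] 1 + 1 ⊗ₜ[k] ι₀ (ι k x) := by
    intro x
    rw [hΔι, AlgHom.comp_apply, Bialgebra.comulAlgHom_apply, comul_ι, map_add]
    simp only [ιι, Algebra.TensorProduct.map_tmul, map_one]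
  have hεB : ∀ x, ε (ι₀ (ι k x)) = 0 := by
    intro x
    rw [hει, Bialgebra.counitAlgHom_apply, counit_ι]
  let bi : Bialgebra k O := Bialgebra.ofAlgHom Δ ε
    (h.algHom_ext_of_basis B
      (fun i => by
        simp [-ι_apply, hΔB, TensorProduct.add_tmul, TensorProduct.tmul_add,
          Algebra.TensorProduct.one_def, add_assoc])
      (by
        simp [-ι_apply, hΔB, hΔz, TensorProduct.add_tmul, TensorProduct.tmul_add,
          Algebra.TensorProduct.one_def]
        abel))
    (h.algHom_ext_of_basis B (fun i => by simp [-ι_apply, hΔB, hεB])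
      (by simp [-ι_apply, hεB, hΔz, hεz]))
    (h.algHom_ext_of_basis B (fun i => by simp [-ι_apply, hΔB, hεB])
      (by simp [-ι_apply, hεB, hΔz, hεz]))
  exact @IsOreExtension.exists_isGeneralizedHopfOre_of_bialgebra k _ g _ _ B O _ bi ι₀ z τ δ χ v w h
    (fun i => hΔB (B i)) (fun i => hεB (B i)) hΔz hεz hτ hS

end HopfStructure

/-! ### Existence of the three types -/

section Existence

attribute [local instance 100] LieRing.ofAssociativeRing

open UniversalEnvelopingAlgebra

variable {k : Type u} [Field k] {g : Type v} [LieRing g] [LieAlgebra k g]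
  {B : Module.Basis (Fin 2) k g}

theorem IsGeneralizedHopfOre.isHopfOreExtension {H : Type w} [Ring H] [HopfAlgebra k H]
    {ι' : UniversalEnvelopingAlgebra k g →ₐc[k] H} {z : H} {χ : LieAlgebra.LieCharacter k g}
    {τ : UniversalEnvelopingAlgebra k g →ₐ[k] UniversalEnvelopingAlgebra k g}
    {δ : UniversalEnvelopingAlgebra k g →ₗ[k] UniversalEnvelopingAlgebra k g} {v w : g}
    (h : IsGeneralizedHopfOre ι' z τ δ 1 1 (ι k v) (ι k w)) (hτ : τ = winding χ)
    (hvw : ι k v = 0 ↔ ι k w = 0) :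
    IsHopfOreExtension (lift k χ) 1 1 (ι k v) (ι k w) δ ι' z where
  groupLike₁ := .one
  groupLike₂ := .one
  primitive_x := comul_ι k v
  primitive_y := comul_ι k w
  zero_iff := hvw
  ext := ⟨τ, fun a => by rw [hτ, winding_eq_twistedAd], h⟩

/-- A twisted derivation `d : 𝔤 → 𝔤` extends to a twisted derivation of `U(𝔤)`. -/
theorem IsTwistedDerivation.exists_extension {χ : LieAlgebra.LieCharacter k g} {d : g →ₗ[k] g}
    (hd : IsTwistedDerivation B χ d) :
    ∃ δ : UniversalEnvelopingAlgebra k g →ₗ[k] UniversalEnvelopingAlgebra k g,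
      (∀ a b, δ (a * b) = winding χ a * δ b + δ a * b) ∧ ∀ x, δ (ι k x) = ι k (d x) :=
  exists_twistedDerivation B (winding χ) ((ι k).toLinearMap ∘ₗ d) (by
    change ι k (d _) = _ * ι k (d _) + ι k (d _) * _ - _ * ι k (d _) - ι k (d _) * _
    rw [hd, winding_ι, winding_ι]
    simp only [map_add, map_sub, map_smul, ι_lie, add_mul, smul_mul_assoc, one_mul]
    abel)

/-- Existence of the extensions with `x = y = 0`. -/
theorem exists_isUsualType (χ : LieAlgebra.LieCharacter k g) (d : g →ₗ[k] g)
    (hd : IsTwistedDerivation B χ d) :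
    ∃ (H : Type (max u v)) (_ : Ring H) (_ : HopfAlgebra k H)
      (ι' : UniversalEnvelopingAlgebra k g →ₐc[k] H) (z : H), IsUsualType B χ d ι' z := by
  obtain ⟨δ, hδ, hδι⟩ := hd.exists_extension
  obtain ⟨H, _, _, ι', z, h⟩ := exists_isGeneralizedHopfOre (B := B) (v := 0) (w := 0) (χ := χ)
    (fun i => winding_ι χ (B i)) hδ (fun i => by rw [hδι, comul_ι]; simp [-ι_apply])
    (fun i => by rw [hδι, counit_ι]) (fun i => by rw [hδι, antipode_ι]; simp [-ι_apply])
  refine ⟨H, _, _, ι', z, hd, δ, hδι, ?_⟩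
  have := h.isHopfOreExtension rfl Iff.rfl
  rwa [map_zero] at this

theorem ι_basis_ne_zero (hB : IsNormalizedBasis B) (i : Fin 2) : ι k (B i) ≠ 0 := fun h =>
  B.ne_zero i (hB.ι_injective (h.trans (map_zero _).symm))

/-- Existence of the extensions with `x ⊗ y = a ⊗ b` over an abelian Lie algebra. -/
theorem exists_isAbelianType (hB : ⁅B 0, B 1⁆ = 0) (d : g →ₗ[k] g) :
    ∃ (H : Type (max u v)) (_ : Ring H) (_ : HopfAlgebra k H)
      (ι' : UniversalEnvelopingAlgebra k g →ₐc[k] H) (z : H), IsAbelianType B d ι' z := by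
  have hcomm : ∀ x y : g, ι k x * ι k y = ι k y * ι k x := by
    intro x y
    rw [← sub_eq_zero, ← ι_lie, lie_eq_smul_lie_basis B, hB, smul_zero, map_zero]
  obtain ⟨δ, hδ, hδι⟩ := exists_twistedDerivation B (winding 0) ((ι k).toLinearMap ∘ₗ d) (by
    change ι k (d _) = _ * ι k (d _) + ι k (d _) * _ - _ * ι k (d _) - ι k (d _) * _
    rw [hB, winding_ι, winding_ι]
    simp only [LieHom.zero_apply, zero_smul, add_zero, map_zero]
    rw [hcomm (B 0), hcomm (B 1)]
    abel)
  replace hδι : ∀ x, δ (ι k x) = ι k (d x) := hδι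
  obtain ⟨H, _, _, ι', z, h⟩ := exists_isGeneralizedHopfOre (B := B) (v := B 0) (w := B 1)
    (χ := (0 : LieAlgebra.LieCharacter k g)) (fun i => winding_ι 0 (B i)) hδ
    (fun i => by
      rw [hδι, comul_ι]
      simp only [LieHom.zero_apply, zero_smul, sub_zero, mul_add, add_mul,
        Algebra.TensorProduct.tmul_mul_tmul, one_mul, mul_one]
      rw [hcomm (B i) (B 0), hcomm (B i) (B 1)]
      abel)
    (fun i => by rw [hδι, counit_ι])
    (fun i => by
      rw [hδι, antipode_ι, mul_assoc, hcomm (B 1), ← mul_assoc, ← mul_assoc, hcomm (B i) (B 0)]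
      simp [-ι_apply])
  have hn : IsNormalizedBasis B := Or.inl hB
  exact ⟨H, _, _, ι', z, hB, δ, hδι, h.isHopfOreExtension rfl
    (iff_of_false (ι_basis_ne_zero hn 0) (ι_basis_ne_zero hn 1))⟩

/-- Existence of the extensions with `x ⊗ y = a ⊗ b` over the nonabelian Lie algebra. -/
theorem exists_isNonabelianType [CharZero k] (hB : ⁅B 0, B 1⁆ = B 0) (η ζ : k) :
    ∃ (H : Type (max u v)) (_ : Ring H) (_ : HopfAlgebra k H)
      (ι' : UniversalEnvelopingAlgebra k g →ₐc[k] H) (z : H), IsNonabelianType B η ζ ι' z := by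
  let χ : LieAlgebra.LieCharacter k g := lieHomOfBasis B (B.constr k ![0, 1]) (by
    rw [hB, LieRing.of_associative_ring_bracket]
    simp)
  have hχ0 : χ (B 0) = 0 := by simp [χ, lieHomOfBasis_apply]
  have hχ1 : χ (B 1) = 1 := by simp [χ, lieHomOfBasis_apply]
  have hab : ι k (B 1) * ι k (B 0) = ι k (B 0) * ι k (B 1) - ι k (B 0) := by
    have h := ι_lie (k := k) (B 0) (B 1)
    rw [hB] at h
    rwa [eq_sub_iff_add_eq, ← eq_sub_iff_add_eq']
  let D : g →ₗ[k] UniversalEnvelopingAlgebra k g :=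
    B.constr k ![η • ι k (B 0) - (1 / 2 : k) • ι k (B 0) ^ 2, ζ • ι k (B 0) + η • ι k (B 1)]
  have hD0 : D (B 0) = η • ι k (B 0) - (1 / 2 : k) • ι k (B 0) ^ 2 := by simp [D, -ι_apply]
  have hD1 : D (B 1) = ζ • ι k (B 0) + η • ι k (B 1) := by simp [D, -ι_apply]
  have hbaa : ι k (B 1) * (ι k (B 0) * ι k (B 0)) =
      ι k (B 0) * (ι k (B 0) * ι k (B 1)) - 2 • (ι k (B 0) * ι k (B 0)) := by
    rw [← mul_assoc, hab, sub_mul, mul_assoc, hab, mul_sub]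
    abel
  obtain ⟨δ, hδ, hδι⟩ := exists_twistedDerivation B (winding χ) D (by
    rw [hB, winding_ι, winding_ι, hD0, hD1, hχ0, hχ1]
    simp only [pow_two, mul_add, mul_sub, add_mul, sub_mul, mul_smul_comm, smul_mul_assoc, one_mul,
      zero_smul, add_zero, one_smul, hab, hbaa, mul_assoc]
    module)
  obtain ⟨H, _, _, ι', z, h⟩ := exists_isGeneralizedHopfOre (B := B) (v := B 0) (w := B 1)
    (χ := χ) (fun i => winding_ι χ (B i)) hδ
    (Fin.forall_fin_two.2 ⟨by
      rw [hδι, hD0, hχ0]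
      simp only [pow_two, map_sub, map_smul, Bialgebra.comul_mul, comul_ι, mul_add, add_mul,
        Algebra.TensorProduct.tmul_mul_tmul, one_mul, mul_one, hab, TensorProduct.sub_tmul,
        TensorProduct.tmul_sub, TensorProduct.tmul_smul, ← TensorProduct.smul_tmul', zero_smul]
      module, by
      rw [hδι, hD1, hχ1]
      simp only [map_add, map_smul, comul_ι, mul_add, add_mul,
        Algebra.TensorProduct.tmul_mul_tmul, one_mul, mul_one, hab, TensorProduct.sub_tmul,
        TensorProduct.add_tmul, TensorProduct.tmul_add,
        TensorProduct.tmul_smul, ← TensorProduct.smul_tmul', one_smul]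
      module⟩)
    (Fin.forall_fin_two.2 ⟨by
      rw [hδι, hD0, map_sub, map_smul, map_smul, Bialgebra.counit_pow, counit_ι]
      simp, by
      rw [hδι, hD1, map_add, map_smul, map_smul, counit_ι, counit_ι]
      simp⟩)
    (Fin.forall_fin_two.2 ⟨by
      have hanti : HopfAlgebra.antipode k (ι k (B 0) * ι k (B 0)) = ι k (B 0) * ι k (B 0) := by
        change antipodeLin k g _ = _
        rw [antipodeLin_ι_mul]
        change -(HopfAlgebra.antipode k (ι k (B 0)) * _) = _
        rw [antipode_ι, neg_mul, neg_neg]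
      rw [hδι, hD0, hχ0, map_sub, map_smul, map_smul, antipode_ι, pow_two, hanti, mul_assoc, hab,
        mul_sub, zero_smul, smul_neg]
      module, by
      rw [hδι, hD1, hχ1, map_add, map_smul, map_smul, antipode_ι, antipode_ι, one_smul,
        ← mul_assoc, hab, sub_mul]
      simp only [smul_neg]
      abel⟩)
  have hn : IsNormalizedBasis B := Or.inr hB
  exact ⟨H, _, _, ι', z, hB, χ, δ, hχ0, hχ1, (hδι _).trans hD0, (hδι _).trans hD1,
    h.isHopfOreExtension rfl (iff_of_false (ι_basis_ne_zero hn 0) (ι_basis_ne_zero hn 1))⟩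

end Existence

/-! ### Consequences of coassociativity -/

section CoassociativityAnalysis

variable {k : Type u} [Field k]

section

variable {M N P : Type*} [AddCommGroup M] [Module k M] [AddCommGroup N] [Module k N]
  [AddCommGroup P] [Module k P]

theorem sliceLeft_assoc (φ : M →ₗ[k] k) (t : M ⊗[k] N) (p : P) :
    sliceLeft (N ⊗[k] P) φ (TensorProduct.assoc k M N P (t ⊗ₜ p)) = sliceLeft N φ t ⊗ₜ p := by
  induction t using TensorProduct.induction_on with
  | zero => simp
  | add s t hs ht => simp only [TensorProduct.add_tmul, map_add, hs, ht]
  | tmul m n =>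
    rw [TensorProduct.assoc_tmul, sliceLeft_tmul, sliceLeft_tmul, TensorProduct.smul_tmul']

theorem lTensor_sliceLeft_assoc (φ : N →ₗ[k] k) (t : M ⊗[k] N) (p : P) :
    (sliceLeft P φ).lTensor M (TensorProduct.assoc k M N P (t ⊗ₜ p)) = sliceRight M φ t ⊗ₜ p := by
  induction t using TensorProduct.induction_on with
  | zero => simp
  | add s t hs ht => simp only [TensorProduct.add_tmul, map_add, hs, ht]
  | tmul m n =>
    rw [TensorProduct.assoc_tmul, LinearMap.lTensor_tmul, sliceLeft_tmul, sliceRight_tmul,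
      TensorProduct.smul_tmul]

theorem lTensor_sliceRight_assoc (φ : P →ₗ[k] k) (t : M ⊗[k] N) (p : P) :
    (sliceRight N φ).lTensor M (TensorProduct.assoc k M N P (t ⊗ₜ p)) = φ p • t := by
  induction t using TensorProduct.induction_on with
  | zero => simp
  | add s t hs ht => simp only [TensorProduct.add_tmul, map_add, hs, ht, smul_add]
  | tmul m n =>
    rw [TensorProduct.assoc_tmul, LinearMap.lTensor_tmul, sliceRight_tmul,
      TensorProduct.tmul_smul]

end

/-- In a bialgebra whose only group-like element is `1`, a tensor `x ⊗ y` for which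
`z ⊗ 1 + x ⊗ y + 1 ⊗ z` can be coassociative is either scalar, or `x` and `y` are primitive. -/
theorem scalar_or_primitive_of_cocycle {A : Type v} [Ring A] [Bialgebra k A]
    (hgl : ∀ r : A, Coalgebra.comul (R := k) r = r ⊗ₜ r → Coalgebra.counit (R := k) r = 1 → r = 1)
    {x y : A}
    (h : x ⊗ₜ[k] (y ⊗ₜ[k] (1 : A)) + TensorProduct.assoc k A A A (Coalgebra.comul x ⊗ₜ y) =
      x ⊗ₜ[k] Coalgebra.comul y + 1 ⊗ₜ[k] (x ⊗ₜ[k] y)) :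
    (∃ c : k, x ⊗ₜ[k] y = c • (1 : A) ⊗ₜ[k] (1 : A)) ∨
      (Coalgebra.comul (R := k) x = x ⊗ₜ 1 + 1 ⊗ₜ x ∧
        Coalgebra.comul (R := k) y = y ⊗ₜ 1 + 1 ⊗ₜ y) := by
  have h1 := congrArg (sliceLeft (A ⊗[k] A) (Coalgebra.counit (R := k))) h
  have h2 := congrArg ((sliceLeft A (Coalgebra.counit (R := k))).lTensor A) h
  have h3 := congrArg ((sliceRight A (Coalgebra.counit (R := k))).lTensor A) h
  rw [map_add, map_add, sliceLeft_assoc, sliceLeft_counit_comul, sliceLeft_tmul, sliceLeft_tmul,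
    sliceLeft_tmul, Bialgebra.counit_one, one_smul, add_left_inj] at h1
  rw [map_add, map_add, lTensor_sliceLeft_assoc, sliceRight_counit_comul, LinearMap.lTensor_tmul,
    LinearMap.lTensor_tmul, LinearMap.lTensor_tmul, sliceLeft_counit_comul, sliceLeft_tmul,
    sliceLeft_tmul, add_comm, add_right_inj] at h2
  rw [map_add, map_add, lTensor_sliceRight_assoc, LinearMap.lTensor_tmul,
    LinearMap.lTensor_tmul, LinearMap.lTensor_tmul, sliceRight_counit_comul, sliceRight_tmul,
    sliceRight_tmul, Bialgebra.counit_one, one_smul, add_right_inj] at h3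
  by_cases hx : Coalgebra.counit (R := k) x = 0
  swap
  · have hy : y = Coalgebra.counit (R := k) y • 1 := by
      have h4 := congrArg (sliceLeft A (Coalgebra.counit (R := k))) (smul_right_injective _ hx h1)
      rw [sliceLeft_tmul, sliceLeft_counit_comul] at h4
      exact h4.symm
    refine Or.inl ⟨Coalgebra.counit (R := k) x * Coalgebra.counit (R := k) y, ?_⟩
    conv_lhs => rw [hy]
    rw [h2]
    conv_lhs => rw [hy]
    rw [smul_smul, TensorProduct.tmul_smul]
  by_cases hy : Coalgebra.counit (R := k) y = 0
  swap
  · left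
    have h4 : Coalgebra.comul (R := k) x = 1 ⊗ₜ x :=
      smul_right_injective _ hy (h3.trans (TensorProduct.tmul_smul _ _ _))
    have h5 := congrArg (sliceRight A (Coalgebra.counit (R := k))) h4
    rw [sliceRight_tmul, sliceRight_counit_comul, hx, zero_smul] at h5
    exact ⟨0, by rw [h5, TensorProduct.zero_tmul, zero_smul]⟩
  by_cases hx0 : x = 0
  · exact Or.inl ⟨0, by rw [hx0, TensorProduct.zero_tmul, zero_smul]⟩
  by_cases hy0 : y = 0
  · exact Or.inl ⟨0, by rw [hy0, TensorProduct.tmul_zero, zero_smul]⟩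
  right
  obtain ⟨φ, hφ⟩ := exists_functional_eq_one (k := k) hx0
  obtain ⟨θ, hθ⟩ := exists_functional_eq_one (k := k) hy0
  -- contracting with `φ` shows that `Δ y = y ⊗ 1 + w ⊗ y`, where `w` must be group-like
  obtain ⟨w, hw⟩ : ∃ w : A, Coalgebra.comul (R := k) y = y ⊗ₜ 1 + w ⊗ₜ y := by
    have h4 := congrArg (sliceLeft (A ⊗[k] A) φ) h
    rw [map_add, map_add, sliceLeft_assoc, sliceLeft_tmul, sliceLeft_tmul, sliceLeft_tmul, hφ,
      one_smul, one_smul, TensorProduct.smul_tmul'] at h4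
    refine ⟨sliceLeft A φ (Coalgebra.comul x) - φ 1 • x, ?_⟩
    rw [TensorProduct.sub_tmul, ← add_sub_assoc, h4, add_sub_cancel_right]
  have hwε : Coalgebra.counit (R := k) w = 1 := by
    have h4 := congrArg (sliceLeft A (Coalgebra.counit (R := k))) hw
    rw [sliceLeft_counit_comul, map_add, sliceLeft_tmul, sliceLeft_tmul, hy, zero_smul,
      zero_add] at h4
    have h5 := congrArg θ h4
    rw [map_smul, hθ, smul_eq_mul, mul_one] at h5
    exact h5.symm
  have hwΔ : Coalgebra.comul (R := k) w = w ⊗ₜ w := by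
    have h4 := Coalgebra.coassoc_apply (R := k) y
    rw [hw, map_add, map_add, map_add, LinearMap.rTensor_tmul, LinearMap.rTensor_tmul,
      LinearMap.lTensor_tmul, LinearMap.lTensor_tmul, Bialgebra.comul_one, hw,
      TensorProduct.add_tmul, map_add, TensorProduct.assoc_tmul, TensorProduct.assoc_tmul,
      TensorProduct.tmul_add, Algebra.TensorProduct.one_def, ← add_assoc, add_right_inj] at h4
    have h5 := congrArg ((sliceRight A θ).lTensor A) h4
    rw [lTensor_sliceRight_assoc, LinearMap.lTensor_tmul, sliceRight_tmul, hθ, one_smul,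
      one_smul] at h5
    exact h5
  have hw1 := hgl w hwΔ hwε
  rw [hw1] at hw
  refine ⟨?_, hw⟩
  rw [hw, TensorProduct.tmul_add, add_assoc, add_right_inj] at h
  have h5 := congrArg ((sliceRight A θ).lTensor A) h
  rw [map_add, lTensor_sliceRight_assoc, LinearMap.lTensor_tmul, LinearMap.lTensor_tmul,
    sliceRight_tmul, sliceRight_tmul, hθ, one_smul, one_smul, one_smul] at h5
  exact h5

namespace IsGeneralizedHopfOre

variable {A : Type v} [Ring A] [HopfAlgebra k A] {H : Type w} [Ring H] [HopfAlgebra k H]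
  {ι : A →ₐc[k] H} {z : H} {τ : A →ₐ[k] A} {δ : A →ₗ[k] A} {r₁ r₂ x y : A}

theorem exists_retraction (h : IsGeneralizedHopfOre ι z τ δ r₁ r₂ x y) :
    ∃ p : H →ₗ[k] A, ∀ a, p (ι a) = a := by
  obtain ⟨p, hp⟩ := LinearMap.exists_leftInverse_of_injective
    ((ι : A →ₐ[k] H).toLinearMap) (LinearMap.ker_eq_bot.2 h.ore.injective)
  exact ⟨p, fun a => LinearMap.congr_fun hp a⟩

/-- The embedding of `A` is injective on tensors. -/
theorem map_tensor_injective (h : IsGeneralizedHopfOre ι z τ δ r₁ r₂ x y) :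
    Function.Injective
      (Algebra.TensorProduct.map (ι : A →ₐ[k] H) (ι : A →ₐ[k] H)) := by
  obtain ⟨p, hp⟩ := h.exists_retraction
  refine Function.LeftInverse.injective (g := TensorProduct.map p p) fun t => ?_
  induction t using TensorProduct.induction_on with
  | zero => simp
  | add s t hs ht => rw [map_add, map_add, hs, ht]
  | tmul a b =>
    rw [Algebra.TensorProduct.map_tmul, TensorProduct.map_tmul]
    exact congrArg₂ _ (hp a) (hp b)

theorem comul_ι (ι : A →ₐc[k] H) (a : A) : Coalgebra.comul (R := k) (ι a) =
    Algebra.TensorProduct.map (ι : A →ₐ[k] H) (ι : A →ₐ[k] H) (Coalgebra.comul a) :=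
  (CoalgHomClass.map_comp_comul_apply ι a).symm

/-- The counit of the coefficient of `z` is a functional `φ` vanishing on `A`. -/
theorem exists_functional (h : IsGeneralizedHopfOre ι z τ δ r₁ r₂ x y) :
    ∃ φ : H →ₗ[k] k, (∀ a, φ (ι a) = 0) ∧
      (∀ a, φ (ι a * z) = Coalgebra.counit (R := k) a) ∧ φ z = 1 := by
  obtain ⟨c, hc0, hc1⟩ := h.ore.exists_coeff
  refine ⟨Coalgebra.counit ∘ₗ c, fun a => ?_, fun a => ?_, ?_⟩
  · have h0 : c (ι a) = 0 := hc0 a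
    rw [LinearMap.comp_apply, h0, map_zero]
  · exact congrArg _ (hc1 a)
  · have h1 := hc1 1
    rw [map_one, one_mul] at h1
    rw [LinearMap.comp_apply, h1, Bialgebra.counit_one]

theorem sliceLeft_map_eq_zero {φ : H →ₗ[k] k} (hφ : ∀ a, φ (ι a) = 0) (t : A ⊗[k] A) :
    sliceLeft H φ (Algebra.TensorProduct.map (ι : A →ₐ[k] H) (ι : A →ₐ[k] H) t) = 0 := by
  induction t using TensorProduct.induction_on with
  | zero => simp
  | add s t hs ht => rw [map_add, map_add, hs, ht, add_zero]
  | tmul a b =>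
    rw [Algebra.TensorProduct.map_tmul, sliceLeft_tmul]
    exact (congrArg (· • _) (hφ a)).trans (zero_smul _ _)

theorem isGroupLike_left (h : IsGeneralizedHopfOre ι z τ δ r₁ r₂ x y) :
    Coalgebra.comul (R := k) r₁ = r₁ ⊗ₜ r₁ ∧ Coalgebra.counit (R := k) r₁ = 1 := by
  obtain ⟨φ, hφ, -, hφz⟩ := h.exists_functional
  constructor
  · apply h.map_tensor_injective
    rw [← comul_ι, Algebra.TensorProduct.map_tmul]
    have h4 := Coalgebra.coassoc_apply (R := k) z
    have h5 := congrArg (sliceLeft (H ⊗[k] H) φ) h4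
    rw [h.comul_z] at h5
    simp only [map_add, LinearMap.rTensor_tmul, LinearMap.lTensor_tmul, sliceLeft_assoc,
      sliceLeft_tmul, h.comul_z, hφ, hφz, comul_ι, sliceLeft_map_eq_zero hφ, zero_smul,
      TensorProduct.zero_tmul, add_zero, one_smul] at h5
    rw [comul_ι]
    exact h5.symm
  · have h4 := sliceRight_counit_comul (k := k) z
    have h5 := congrArg φ h4
    rw [h.comul_z] at h5
    simp only [map_add, sliceRight_tmul, map_smul, hφ, hφz, CoalgHomClass.counit_comp_apply,
      smul_eq_mul, mul_zero, add_zero, mul_one] at h5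
    exact h5

theorem isGroupLike_right (h : IsGeneralizedHopfOre ι z τ δ r₁ r₂ x y) :
    Coalgebra.comul (R := k) r₂ = r₂ ⊗ₜ r₂ ∧ Coalgebra.counit (R := k) r₂ = 1 := by
  obtain ⟨φ, hφ, -, hφz⟩ := h.exists_functional
  have hR : ∀ t : A ⊗[k] A, (sliceRight H φ)
      (Algebra.TensorProduct.map (ι : A →ₐ[k] H) (ι : A →ₐ[k] H) t) = 0 := by
    intro t
    induction t using TensorProduct.induction_on with
    | zero => simp
    | add s t hs ht => rw [map_add, map_add, hs, ht, add_zero]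
    | tmul a b =>
      rw [Algebra.TensorProduct.map_tmul, sliceRight_tmul]
      exact (congrArg (· • _) (hφ b)).trans (zero_smul _ _)
  constructor
  · apply h.map_tensor_injective
    rw [← comul_ι, Algebra.TensorProduct.map_tmul]
    have h4 := Coalgebra.coassoc_apply (R := k) z
    have h5 := congrArg ((sliceRight H φ).lTensor H) h4
    rw [h.comul_z] at h5
    simp only [map_add, LinearMap.rTensor_tmul, LinearMap.lTensor_tmul, lTensor_sliceRight_assoc,
      sliceRight_tmul, h.comul_z, hφ, hφz, comul_ι, hR, zero_smul, TensorProduct.tmul_zero,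
      zero_add, one_smul] at h5
    rw [comul_ι]
    exact h5
  · have h4 := sliceLeft_counit_comul (k := k) z
    have h5 := congrArg φ h4
    rw [h.comul_z] at h5
    simp only [map_add, sliceLeft_tmul, map_smul, hφ, hφz, CoalgHomClass.counit_comp_apply,
      smul_eq_mul, mul_zero, zero_add, mul_one] at h5
    exact h5

theorem cocycle (h : IsGeneralizedHopfOre ι z τ δ 1 1 x y) :
    x ⊗ₜ[k] (y ⊗ₜ[k] (1 : A)) + TensorProduct.assoc k A A A (Coalgebra.comul x ⊗ₜ y) =
      x ⊗ₜ[k] Coalgebra.comul y + 1 ⊗ₜ[k] (x ⊗ₜ[k] y) := by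
  obtain ⟨p, hp⟩ := h.exists_retraction
  have hp1 : p 1 = 1 := by
    have := hp 1
    rwa [map_one] at this
  have hpp : ∀ t : A ⊗[k] A, TensorProduct.map p p
      (Algebra.TensorProduct.map (ι : A →ₐ[k] H) (ι : A →ₐ[k] H) t) = t := by
    intro t
    induction t using TensorProduct.induction_on with
    | zero => simp
    | add s t hs ht => rw [map_add, map_add, hs, ht]
    | tmul a b =>
      rw [Algebra.TensorProduct.map_tmul, TensorProduct.map_tmul]
      exact congrArg₂ _ (hp a) (hp b)
  have hz := h.comul_z
  rw [map_one] at hz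
  have h4 := Coalgebra.coassoc_apply (R := k) z
  rw [hz] at h4
  simp only [map_add, LinearMap.rTensor_tmul, LinearMap.lTensor_tmul, hz, Bialgebra.comul_one,
    Algebra.TensorProduct.one_def, TensorProduct.add_tmul, TensorProduct.assoc_tmul,
    TensorProduct.tmul_add] at h4
  have h6 : ι x ⊗ₜ[k] (ι y ⊗ₜ[k] (1 : H)) +
      TensorProduct.assoc k H H H (Coalgebra.comul (ι x) ⊗ₜ ι y) =
      ι x ⊗ₜ[k] Coalgebra.comul (ι y) + 1 ⊗ₜ[k] (ι x ⊗ₜ[k] ι y) := by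
    rw [← sub_eq_zero] at h4 ⊢
    rw [← h4]
    abel
  have h7 := congrArg (TensorProduct.map p (TensorProduct.map p p)) h6
  rw [map_add, map_add, TensorProduct.map_map_assoc] at h7
  simpa only [TensorProduct.map_tmul, comul_ι, hpp, hp, hp1] using h7

end IsGeneralizedHopfOre

end CoassociativityAnalysis

/-! ### The classification -/

section Classification

attribute [local instance 100] LieRing.ofAssociativeRing

open UniversalEnvelopingAlgebra

variable {k : Type u} [Field k] {g : Type v} [LieRing g] [LieAlgebra k g]
  {B : Module.Basis (Fin 2) k g}

section

variable {H : Type w} [Ring H] [HopfAlgebra k H]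
  {ι' : UniversalEnvelopingAlgebra k g →ₐc[k] H} {z : H}
  {τ : UniversalEnvelopingAlgebra k g →ₐ[k] UniversalEnvelopingAlgebra k g}
  {δ : UniversalEnvelopingAlgebra k g →ₗ[k] UniversalEnvelopingAlgebra k g}
  {r₁ r₂ x y : UniversalEnvelopingAlgebra k g}

namespace IsGeneralizedHopfOre

theorem comul_z_one (h : IsGeneralizedHopfOre ι' z τ δ 1 1 x y) :
    Coalgebra.comul (R := k) z = z ⊗ₜ[k] 1 + ι' x ⊗ₜ[k] ι' y + 1 ⊗ₜ[k] z := by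
  rw [h.comul_z, map_one]

/-- The twist is the winding automorphism of the character `u ↦ ε(τ(u))`. -/
theorem exists_eq_winding (h : IsGeneralizedHopfOre ι' z τ δ 1 1 x y) :
    ∃ χ : LieAlgebra.LieCharacter k g, τ = winding χ := by
  let χ : LieAlgebra.LieCharacter k g :=
    (lift k).symm ((Bialgebra.counitAlgHom k (UniversalEnvelopingAlgebra k g)).comp τ)
  have hχ : ∀ u, χ u = Coalgebra.counit (R := k) (τ (ι k u)) := fun u => rfl
  refine ⟨χ, algHom_eq fun u => ?_⟩
  rw [winding_ι, hχ]
  apply h.ore.injective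
  obtain ⟨φ, hφ, hφm, hφz⟩ := h.exists_functional
  have hφ1 : φ 1 = 0 := by
    have := hφ 1
    rwa [map_one] at this
  have hr : z * ι' (ι k u) = ι' (τ (ι k u)) * z + ι' (δ (ι k u)) := h.ore.rel (ι k u)
  have h1 := congrArg (fun t => sliceLeft H φ (Coalgebra.comul (R := k) t)) hr
  simp only [Bialgebra.comul_mul, map_add, h.comul_z_one] at h1
  rw [IsGeneralizedHopfOre.comul_ι ι' (δ (ι k u)), sliceLeft_map_eq_zero hφ,
    IsGeneralizedHopfOre.comul_ι ι' (ι k u), UniversalEnvelopingAlgebra.comul_ι] at h1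
  have hT : ∀ t : UniversalEnvelopingAlgebra k g ⊗[k] UniversalEnvelopingAlgebra k g,
      sliceLeft H φ
      (Algebra.TensorProduct.map (ι' : _ →ₐ[k] H) (ι' : _ →ₐ[k] H) t *
        (z ⊗ₜ[k] 1 + ι' x ⊗ₜ[k] ι' y + 1 ⊗ₜ[k] z)) =
      ι' (sliceLeft _ (Coalgebra.counit (R := k)) t) := by
    intro t
    induction t using TensorProduct.induction_on with
    | zero => simp
    | add s t hs ht => simp only [map_add, add_mul, hs, ht]
    | tmul a b =>
      have e1 : ((ι' : UniversalEnvelopingAlgebra k g →ₐ[k] H) a) = ι' a := rfl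
      have e2 : ((ι' : UniversalEnvelopingAlgebra k g →ₐ[k] H) b) = ι' b := rfl
      rw [Algebra.TensorProduct.map_tmul, mul_add, mul_add, map_add, map_add, e1, e2,
        Algebra.TensorProduct.tmul_mul_tmul, Algebra.TensorProduct.tmul_mul_tmul,
        Algebra.TensorProduct.tmul_mul_tmul, sliceLeft_tmul, sliceLeft_tmul, sliceLeft_tmul,
        sliceLeft_tmul, hφm, ← map_mul, hφ, mul_one, mul_one, hφ, zero_smul, zero_smul, add_zero,
        add_zero, map_smul]
  rw [IsGeneralizedHopfOre.comul_ι ι' (τ (ι k u)), hT, sliceLeft_counit_comul, add_zero, map_add,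
    Algebra.TensorProduct.map_tmul, Algebra.TensorProduct.map_tmul, map_one] at h1
  have e1 : ((ι' : UniversalEnvelopingAlgebra k g →ₐ[k] H) (ι k u)) = ι' (ι k u) := rfl
  rw [e1] at h1
  have h2 : φ (z * ι' (ι k u)) = Coalgebra.counit (R := k) (τ (ι k u)) := by
    rw [hr, map_add, hφm, hφ, add_zero]
  simp only [add_mul, mul_add, Algebra.TensorProduct.tmul_mul_tmul, mul_one, one_mul, map_add,
    sliceLeft_tmul, ← map_mul, hφ, hφ1, h2, hφz, zero_smul, one_smul, add_zero] at h1
  change ι' (τ (ι k u)) = ι' (ι k u + _)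
  rw [← h1, map_add, map_smul, map_one, add_comm]

/-- The coproduct of `δ(u)` for `u ∈ 𝔤`, from applying `Δ` to `z u = u z + χ(u) z + δ(u)`. -/
theorem comul_delta {χ : LieAlgebra.LieCharacter k g}
    (h : IsGeneralizedHopfOre ι' z (winding χ) δ 1 1 x y) (u : g) :
    Coalgebra.comul (R := k) (δ (ι k u)) = δ (ι k u) ⊗ₜ[k] 1 + 1 ⊗ₜ[k] δ (ι k u) +
      x ⊗ₜ[k] y * (ι k u ⊗ₜ[k] 1 + 1 ⊗ₜ[k] ι k u) -
      (ι k u ⊗ₜ[k] 1 + 1 ⊗ₜ[k] ι k u) * x ⊗ₜ[k] y - χ u • x ⊗ₜ[k] y := by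
  apply h.map_tensor_injective
  rw [← IsGeneralizedHopfOre.comul_ι ι' (δ (ι k u))]
  have hr : z * ι' (ι k u) = ι' (winding χ (ι k u)) * z + ι' (δ (ι k u)) := h.ore.rel (ι k u)
  rw [winding_ι, map_add, map_smul, map_one, add_mul, smul_mul_assoc, one_mul] at hr
  have hd : ι' (δ (ι k u)) = z * ι' (ι k u) - ι' (ι k u) * z - χ u • z := by
    rw [hr]
    abel
  have e1 : ∀ a, ((ι' : UniversalEnvelopingAlgebra k g →ₐ[k] H) a) = ι' a := fun a => rfl
  simp only [map_add, map_sub, map_smul, map_mul, Algebra.TensorProduct.map_tmul, map_one, e1, hd,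
    Bialgebra.comul_mul, h.comul_z_one]
  rw [IsGeneralizedHopfOre.comul_ι ι' (ι k u), UniversalEnvelopingAlgebra.comul_ι]
  simp only [map_add, Algebra.TensorProduct.map_tmul, map_one, e1,
    mul_add, add_mul, Algebra.TensorProduct.tmul_mul_tmul, one_mul, mul_one,
    TensorProduct.sub_tmul, TensorProduct.tmul_sub,
    TensorProduct.tmul_smul, ← TensorProduct.smul_tmul']
  module

/-- Replacing `z` by `c z + q` with `q ∈ U(𝔤)` changes `x ⊗ y` by a coboundary. -/
theorem affine_change (h : IsGeneralizedHopfOre ι' z τ δ 1 1 x y) {c : k} (hc : c ≠ 0)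
    {q x' y' : UniversalEnvelopingAlgebra k g}
    (hq : Coalgebra.comul (R := k) q =
      q ⊗ₜ[k] 1 + 1 ⊗ₜ[k] q + x' ⊗ₜ[k] y' - c • x ⊗ₜ[k] y) :
    ∃ (z' : H) (δ' : UniversalEnvelopingAlgebra k g →ₗ[k] UniversalEnvelopingAlgebra k g),
      IsGeneralizedHopfOre ι' z' τ δ' 1 1 x' y' := by
  refine ⟨c • z + ι' q,
    c • δ + LinearMap.mulLeft k q - LinearMap.mulRight k q ∘ₗ τ.toLinearMap, ?_, ?_⟩
  · exact h.ore.affine_change hc q fun a => rfl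
  · have e1 : ∀ a, ((ι' : UniversalEnvelopingAlgebra k g →ₐ[k] H) a) = ι' a := fun a => rfl
    rw [map_add, map_smul, h.comul_z_one, IsGeneralizedHopfOre.comul_ι ι' q, hq, map_one]
    simp only [map_add, map_sub, map_smul, Algebra.TensorProduct.map_tmul, map_one, e1,
      TensorProduct.add_tmul, TensorProduct.tmul_add,
      TensorProduct.tmul_smul, ← TensorProduct.smul_tmul']
    module

theorem eq_one_and_eq_one [CharZero k] (hB : IsNormalizedBasis B)
    (h : IsGeneralizedHopfOre ι' z τ δ r₁ r₂ x y) : r₁ = 1 ∧ r₂ = 1 :=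
  ⟨hB.eq_one_of_isGroupLike h.isGroupLike_left.1 h.isGroupLike_left.2,
    hB.eq_one_of_isGroupLike h.isGroupLike_right.1 h.isGroupLike_right.2⟩

/-- By an affine change of `z` one achieves `x ⊗ y = 0` or `x ⊗ y = a ⊗ b`: the symmetric part of
`x ⊗ y` is the coboundary of a quadratic element. -/
theorem exists_reduced [CharZero k] (hB : IsNormalizedBasis B)
    (h : IsGeneralizedHopfOre ι' z τ δ 1 1 x y) :
    ∃ (z' : H) (δ' : UniversalEnvelopingAlgebra k g →ₗ[k] UniversalEnvelopingAlgebra k g),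
      IsGeneralizedHopfOre ι' z' τ δ' 1 1 (ι k 0) (ι k 0) ∨
      IsGeneralizedHopfOre ι' z' τ δ' 1 1 (ι k (B 0)) (ι k (B 1)) := by
  rcases scalar_or_primitive_of_cocycle (fun r => hB.eq_one_of_isGroupLike) h.cocycle with
    ⟨c, hc⟩ | ⟨hx, hy⟩
  · obtain ⟨z', δ', h'⟩ := h.affine_change one_ne_zero (q := c • 1) (x' := ι k 0) (y' := ι k 0) (by
      rw [hc, map_smul, Bialgebra.comul_one, map_zero, TensorProduct.zero_tmul,
        TensorProduct.tmul_smul, ← TensorProduct.smul_tmul', Algebra.TensorProduct.one_def]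
      module)
    exact ⟨z', δ', Or.inl h'⟩
  obtain ⟨v, rfl⟩ := hB.exists_eq_ι_of_primitive hx
  obtain ⟨w, rfl⟩ := hB.exists_eq_ι_of_primitive hy
  have hv := basis_expand B v
  have hw := basis_expand B w
  set v0 := B.repr v 0
  set v1 := B.repr v 1
  set w0 := B.repr w 0
  set w1 := B.repr w 1
  -- the coboundary of `q` is `x ⊗ y` up to sign and a multiple of `a ⊗ b`
  let q : UniversalEnvelopingAlgebra k g := -((v0 * w0 / 2) • (ι k (B 0) * ι k (B 0)) +
    (v1 * w1 / 2) • (ι k (B 1) * ι k (B 1)) + (v1 * w0) • (ι k (B 0) * ι k (B 1)))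
  have hq : Coalgebra.comul (R := k) q = q ⊗ₜ[k] 1 + 1 ⊗ₜ[k] q +
      (v0 * w1 - v1 * w0) • ι k (B 0) ⊗ₜ[k] ι k (B 1) - ι k v ⊗ₜ[k] ι k w := by
    rw [hv, hw]
    simp only [q, map_neg, map_add, map_smul, Bialgebra.comul_mul,
      UniversalEnvelopingAlgebra.comul_ι, mul_add, add_mul, Algebra.TensorProduct.tmul_mul_tmul,
      one_mul, mul_one, TensorProduct.neg_tmul, TensorProduct.tmul_neg, TensorProduct.add_tmul,
      TensorProduct.tmul_add, TensorProduct.tmul_smul, ← TensorProduct.smul_tmul']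
    module
  by_cases hD : v0 * w1 - v1 * w0 = 0
  · have h0 : ι k (0 : g) = 0 := map_zero _
    obtain ⟨z', δ', h'⟩ := h.affine_change one_ne_zero (q := q) (x' := ι k 0) (y' := ι k 0) (by
      rw [hq, hD, h0, TensorProduct.zero_tmul, zero_smul, one_smul])
    exact ⟨z', δ', Or.inl h'⟩
  · obtain ⟨z', δ', h'⟩ := h.affine_change (inv_ne_zero hD) (q := (v0 * w1 - v1 * w0)⁻¹ • q)
      (x' := ι k (B 0)) (y' := ι k (B 1)) (by
        rw [map_smul, hq, smul_sub, smul_add, smul_smul, inv_mul_cancel₀ hD, one_smul, smul_add,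
          TensorProduct.tmul_smul, TensorProduct.smul_tmul'])
    exact ⟨z', δ', Or.inr h'⟩

theorem delta_ι_lie {χ : LieAlgebra.LieCharacter k g}
    (h : IsGeneralizedHopfOre ι' z (winding χ) δ 1 1 x y) (u v : g) :
    δ (ι k ⁅u, v⁆) = ι k u * δ (ι k v) - δ (ι k v) * ι k u + δ (ι k u) * ι k v -
      ι k v * δ (ι k u) + χ u • δ (ι k v) - χ v • δ (ι k u) := by
  rw [ι_lie, map_sub, h.ore.leibniz, h.ore.leibniz, winding_ι, winding_ι]
  simp only [add_mul, smul_mul_assoc, one_mul]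
  abel

end IsGeneralizedHopfOre

end

/-- `U(𝔤)` is cocommutative. -/
theorem comm_comul (u : UniversalEnvelopingAlgebra k g) :
    Algebra.TensorProduct.comm k _ _ (Coalgebra.comul (R := k) u) = Coalgebra.comul (R := k) u := by
  have : (Algebra.TensorProduct.comm k _ _).toAlgHom.comp
      (Bialgebra.comulAlgHom k (UniversalEnvelopingAlgebra k g)) = Bialgebra.comulAlgHom k _ :=
    algHom_eq fun x => by
      simp [-ι_apply, UniversalEnvelopingAlgebra.comul_ι, add_comm]
  exact congrArg (fun f => f u) this

/-- The antisymmetric cocycle `a ⊗ b` is not a coboundary in the cocommutative `U(𝔤)`. -/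
theorem IsNormalizedBasis.eq_zero_of_comul (hB : IsNormalizedBasis B) {c : k}
    {u : UniversalEnvelopingAlgebra k g}
    (hu : Coalgebra.comul (R := k) u = u ⊗ₜ[k] 1 + 1 ⊗ₜ[k] u + c • ι k (B 0) ⊗ₜ[k] ι k (B 1)) :
    c = 0 := by
  obtain ⟨α, β, h1, h2, h3, h4⟩ := hB.exists_dual
  have h := comm_comul (k := k) u
  rw [hu] at h
  simp only [map_add, map_smul, Algebra.TensorProduct.comm_tmul] at h
  have h' : c • ι k (B 1) ⊗ₜ[k] ι k (B 0) = c • ι k (B 0) ⊗ₜ[k] ι k (B 1) := by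
    rw [← sub_eq_zero] at h ⊢
    rw [← h]
    abel
  have h'' := congrArg (fun t => β (sliceLeft _ α t)) h'
  simp only [map_smul, sliceLeft_tmul, h1, h2, h3, h4, smul_eq_mul] at h''
  simpa using h''.symm

section

variable {H : Type w} [Ring H] [HopfAlgebra k H]
  {ι' : UniversalEnvelopingAlgebra k g →ₐc[k] H} {z : H} {χ : LieAlgebra.LieCharacter k g}
  {δ : UniversalEnvelopingAlgebra k g →ₗ[k] UniversalEnvelopingAlgebra k g}

/-- If `δ` maps the basis vectors into `𝔤`, it restricts to a linear endomorphism of `𝔤`. -/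
theorem exists_linearMap_of_basis (B : Module.Basis (Fin 2) k g)
    (h : ∀ i, ∃ v : g, δ (ι k (B i)) = ι k v) :
    ∃ d : g →ₗ[k] g, ∀ c : g, δ (ι k c) = ι k (d c) := by
  choose f hf using h
  have : δ ∘ₗ (ι k).toLinearMap = (ι k).toLinearMap ∘ₗ B.constr k f := B.ext fun i => by
    change δ (ι k (B i)) = ι k (B.constr k f (B i))
    rw [Module.Basis.constr_basis, hf]
  exact ⟨B.constr k f, fun c => LinearMap.congr_fun this c⟩

theorem IsGeneralizedHopfOre.exists_isUsualType [CharZero k] (hB : IsNormalizedBasis B)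
    (h : IsGeneralizedHopfOre ι' z (winding χ) δ 1 1 (ι k 0) (ι k 0)) :
    ∃ d : g →ₗ[k] g, IsUsualType B χ d ι' z := by
  obtain ⟨d, hd⟩ := exists_linearMap_of_basis (δ := δ) B fun i =>
    hB.exists_eq_ι_of_primitive (by
      have := h.comul_delta (B i)
      rw [map_zero] at this
      simpa only [TensorProduct.zero_tmul, zero_mul, mul_zero, smul_zero, add_zero,
        sub_zero] using this)
  have hext := h.isHopfOreExtension rfl Iff.rfl
  rw [map_zero] at hext
  refine ⟨d, hB.ι_injective ?_, δ, hd, hext⟩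
  rw [← hd, h.delta_ι_lie]
  simp only [map_add, map_sub, map_smul, ι_lie, hd]
  abel

theorem IsGeneralizedHopfOre.exists_isAbelianType [CharZero k] (hB : ⁅B 0, B 1⁆ = 0)
    (h : IsGeneralizedHopfOre ι' z (winding χ) δ 1 1 (ι k (B 0)) (ι k (B 1))) :
    ∃ d : g →ₗ[k] g, IsAbelianType B d ι' z := by
  have hn : IsNormalizedBasis B := Or.inl hB
  have hcomm : ∀ x y : g, ι k x * ι k y = ι k y * ι k x := by
    intro x y
    rw [← sub_eq_zero, ← ι_lie, lie_eq_smul_lie_basis B, hB, smul_zero, map_zero]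
  have hδ : ∀ u : g, Coalgebra.comul (R := k) (δ (ι k u)) = δ (ι k u) ⊗ₜ[k] 1 +
      1 ⊗ₜ[k] δ (ι k u) + (-χ u) • ι k (B 0) ⊗ₜ[k] ι k (B 1) := by
    intro u
    rw [h.comul_delta]
    simp only [mul_add, add_mul, Algebra.TensorProduct.tmul_mul_tmul, one_mul, mul_one]
    rw [hcomm u (B 0), hcomm u (B 1)]
    module
  have hχ : χ = 0 := LieHom.ext fun u => neg_eq_zero.1 (hn.eq_zero_of_comul (hδ u))
  subst hχ
  obtain ⟨d, hd⟩ := exists_linearMap_of_basis (δ := δ) B fun i =>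
    hn.exists_eq_ι_of_primitive (by
      rw [hδ, LieHom.zero_apply, neg_zero, zero_smul, add_zero])
  exact ⟨d, hB, δ, hd, h.isHopfOreExtension rfl
    (iff_of_false (ι_basis_ne_zero hn 0) (ι_basis_ne_zero hn 1))⟩

theorem IsGeneralizedHopfOre.exists_isNonabelianType [CharZero k] (hB : ⁅B 0, B 1⁆ = B 0)
    (h : IsGeneralizedHopfOre ι' z (winding χ) δ 1 1 (ι k (B 0)) (ι k (B 1))) :
    ∃ η ζ : k, IsNonabelianType B η ζ ι' z := by
  have hn : IsNormalizedBasis B := Or.inr hB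
  have hab : ι k (B 1) * ι k (B 0) = ι k (B 0) * ι k (B 1) - ι k (B 0) := by
    have h := ι_lie (k := k) (B 0) (B 1)
    rw [hB] at h
    rwa [eq_sub_iff_add_eq, ← eq_sub_iff_add_eq']
  have hχ0 : χ (B 0) = 0 := by
    rw [← hB]
    exact LieAlgebra.lieCharacter_apply_lie χ _ _
  have hδ1 : Coalgebra.comul (R := k) (δ (ι k (B 1))) = δ (ι k (B 1)) ⊗ₜ[k] 1 +
      1 ⊗ₜ[k] δ (ι k (B 1)) + (1 - χ (B 1)) • ι k (B 0) ⊗ₜ[k] ι k (B 1) := by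
    rw [h.comul_delta]
    simp only [mul_add, add_mul, Algebra.TensorProduct.tmul_mul_tmul, one_mul, mul_one, hab,
      TensorProduct.sub_tmul]
    module
  have hχ1 : χ (B 1) = 1 := (sub_eq_zero.1 (hn.eq_zero_of_comul hδ1)).symm
  rw [hχ1, sub_self, zero_smul, add_zero] at hδ1
  have hδ0 : Coalgebra.comul (R := k) (δ (ι k (B 0)) + (1 / 2 : k) • ι k (B 0) ^ 2) =
      (δ (ι k (B 0)) + (1 / 2 : k) • ι k (B 0) ^ 2) ⊗ₜ[k] 1 +
      1 ⊗ₜ[k] (δ (ι k (B 0)) + (1 / 2 : k) • ι k (B 0) ^ 2) := by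
    rw [map_add, map_smul, pow_two, Bialgebra.comul_mul, UniversalEnvelopingAlgebra.comul_ι,
      h.comul_delta, hχ0]
    simp only [mul_add, add_mul, Algebra.TensorProduct.tmul_mul_tmul, one_mul, mul_one, hab,
      TensorProduct.tmul_sub, TensorProduct.add_tmul, TensorProduct.tmul_add,
      TensorProduct.tmul_smul, ← TensorProduct.smul_tmul']
    module
  obtain ⟨v, hv⟩ := hn.exists_eq_ι_of_primitive hδ0
  obtain ⟨w, hw⟩ := hn.exists_eq_ι_of_primitive hδ1
  rw [← eq_sub_iff_add_eq] at hv
  -- `δ` preserves the relation `[a, b] = a`, which ties `δ(a)` to `δ(b)`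
  have hlie := h.delta_ι_lie (B 0) (B 1)
  have hv' := basis_expand B v
  have hw' := basis_expand B w
  set v0 := B.repr v 0
  set v1 := B.repr v 1
  set w0 := B.repr w 0
  set w1 := B.repr w 1
  have hbaa : ι k (B 1) * (ι k (B 0) * ι k (B 0)) =
      ι k (B 0) * (ι k (B 0) * ι k (B 1)) - 2 • (ι k (B 0) * ι k (B 0)) := by
    rw [← mul_assoc, hab, sub_mul, mul_assoc, hab, mul_sub]
    abel
  have hlin : ι k ((w1 - v0) • B 0 - (2 * v1) • B 1) = 0 := by
    rw [hB, hv, hw, hχ0, hχ1, hv', hw'] at hlie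
    simp only [map_add, map_smul, pow_two, mul_add, mul_sub, add_mul, sub_mul, mul_smul_comm,
      smul_mul_assoc, zero_smul, one_smul, hab, hbaa, mul_assoc] at hlie
    rw [map_sub, map_smul, map_smul]
    rw [← sub_eq_zero] at hlie
    rw [← neg_eq_zero, ← hlie]
    module
  have h0 := hn.ι_injective (hlin.trans (map_zero _).symm)
  have e0 := congrArg (fun x => B.repr x 0) h0
  have e1 := congrArg (fun x => B.repr x 1) h0
  simp at e0 e1
  have hw1 : w1 = v0 := sub_eq_zero.1 e0
  refine ⟨v0, w0, hB, χ, δ, hχ0, hχ1, ?_, ?_, h.isHopfOreExtension rfl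
    (iff_of_false (ι_basis_ne_zero hn 0) (ι_basis_ne_zero hn 1))⟩
  · rw [hv, hv', e1, zero_smul, add_zero, map_smul]
  · rw [hw, hw', hw1, map_add, map_smul, map_smul]

end

/-- The classification: the variable of a generalized Hopf-Ore extension of `U(𝔤)` can be changed so
that the extension is of one of the three types. -/
theorem IsGeneralizedHopfOre.exists_type [CharZero k] {H : Type w} [Ring H] [HopfAlgebra k H]
    {ι' : UniversalEnvelopingAlgebra k g →ₐc[k] H} {z : H}
    {τ : UniversalEnvelopingAlgebra k g →ₐ[k] UniversalEnvelopingAlgebra k g}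
    {δ : UniversalEnvelopingAlgebra k g →ₗ[k] UniversalEnvelopingAlgebra k g}
    {x y : UniversalEnvelopingAlgebra k g} (hB : IsNormalizedBasis B)
    (h : IsGeneralizedHopfOre ι' z τ δ 1 1 x y) :
    ∃ z' : H, (∃ (χ : LieAlgebra.LieCharacter k g) (d : g →ₗ[k] g), IsUsualType B χ d ι' z') ∨
      (∃ d : g →ₗ[k] g, IsAbelianType B d ι' z') ∨ (∃ η ζ : k, IsNonabelianType B η ζ ι' z') := by
  obtain ⟨χ, rfl⟩ := h.exists_eq_winding
  obtain ⟨z', δ', h' | h'⟩ := h.exists_reduced hB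
  · exact ⟨z', Or.inl ⟨χ, h'.exists_isUsualType hB⟩⟩
  · rcases hB with hB | hB
    · exact ⟨z', Or.inr (Or.inl (h'.exists_isAbelianType hB))⟩
    · exact ⟨z', Or.inr (Or.inr (h'.exists_isNonabelianType hB))⟩

end Classification

/-! ### Enveloping algebras of three-dimensional Lie algebras -/

section EnvelopingAlgebras

attribute [local instance 100] LieRing.ofAssociativeRing

open UniversalEnvelopingAlgebra

variable {k : Type u} [Field k] {g : Type v} [LieRing g] [LieAlgebra k g]
  {B : Module.Basis (Fin 2) k g}

section UsualType

variable {H : Type w} [Ring H] [HopfAlgebra k H]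
  {ι' : UniversalEnvelopingAlgebra k g →ₐc[k] H} {z : H} {χ : LieAlgebra.LieCharacter k g}
  {d : g →ₗ[k] g}

namespace IsUsualType

theorem exists_isGeneralizedHopfOre (h : IsUsualType B χ d ι' z) :
    ∃ δ : UniversalEnvelopingAlgebra k g →ₗ[k] UniversalEnvelopingAlgebra k g,
      (∀ c : g, δ (ι k c) = ι k (d c)) ∧ IsGeneralizedHopfOre ι' z (winding χ) δ 1 1 0 0 := by
  obtain ⟨-, δ, hδ, hext⟩ := h
  obtain ⟨τ, hτ, h⟩ := hext.ext
  have : τ = winding χ := AlgHom.ext fun a => by rw [hτ, winding_eq_twistedAd]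
  exact ⟨δ, hδ, this ▸ h⟩

theorem rel (h : IsUsualType B χ d ι' z) (x : g) :
    z * ι' (ι k x) = ι' (ι k x) * z + χ x • z + ι' (ι k (d x)) := by
  obtain ⟨δ, hδ, h'⟩ := h.exists_isGeneralizedHopfOre
  have hr : z * ι' (ι k x) = ι' (winding χ (ι k x)) * z + ι' (δ (ι k x)) := h'.ore.rel (ι k x)
  rw [hr, hδ, winding_ι, map_add, map_smul, map_one, add_mul, smul_mul_assoc, one_mul]

theorem comul_z (h : IsUsualType B χ d ι' z) :
    Coalgebra.comul (R := k) z = z ⊗ₜ[k] 1 + 1 ⊗ₜ[k] z := by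
  obtain ⟨δ, hδ, h'⟩ := h.exists_isGeneralizedHopfOre
  rw [h'.comul_z, map_one, map_zero, TensorProduct.zero_tmul, add_zero]

theorem exists_algHom (h : IsUsualType B χ d ι' z) {R : Type*} [Ring R] [Algebra k R]
    (f : UniversalEnvelopingAlgebra k g →ₐ[k] R) (Z : R)
    (hrel : ∀ x : g, Z * f (ι k x) = f (ι k x) * Z + χ x • Z + f (ι k (d x))) :
    ∃ F : H →ₐ[k] R, (∀ a, F (ι' a) = f a) ∧ F z = Z := by
  obtain ⟨δ, hδ, h'⟩ := h.exists_isGeneralizedHopfOre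
  refine h'.ore.exists_algHom_of_basis B f Z fun i => ?_
  rw [hrel, hδ, winding_ι, map_add, map_smul, map_one, add_mul, smul_mul_assoc, one_mul]

theorem algHom_ext (h : IsUsualType B χ d ι' z) {R : Type*} [Ring R] [Algebra k R]
    {F G : H →ₐ[k] R} (hι : ∀ x : g, F (ι' (ι k x)) = G (ι' (ι k x))) (hz : F z = G z) : F = G := by
  obtain ⟨δ, hδ, h'⟩ := h.exists_isGeneralizedHopfOre
  exact h'.ore.algHom_ext_of_basis B (fun i => hι (B i)) hz

theorem linear_injective (hB : IsNormalizedBasis B) (h : IsUsualType B χ d ι' z) {x : g} {c : k}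
    (hx : ι' (ι k x) + c • z = 0) : x = 0 ∧ c = 0 := by
  obtain ⟨δ, hδ, h'⟩ := h.exists_isGeneralizedHopfOre
  obtain ⟨φ, hφ, -, hφz⟩ := h'.exists_functional
  have hc := congrArg φ hx
  rw [map_add, map_smul, hφ, hφz, map_zero, zero_add, smul_eq_mul, mul_one] at hc
  rw [hc, zero_smul, add_zero] at hx
  refine ⟨hB.ι_injective (h'.ore.injective ?_), hc⟩
  rw [map_zero, map_zero]
  exact hx

end IsUsualType

/-- The linear map `(x, c) ↦ x + c z` from `𝔤 × k` to an extension of `U(𝔤)`. -/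
noncomputable def primitiveMap (ι' : UniversalEnvelopingAlgebra k g →ₐc[k] H) (z : H) :
    (g × k) →ₗ[k] H :=
  ((ι' : UniversalEnvelopingAlgebra k g →ₐ[k] H).toLinearMap ∘ₗ (ι k).toLinearMap).coprod
    (LinearMap.toSpanSingleton k H z)

theorem primitiveMap_apply (p : g × k) : primitiveMap ι' z p = ι' (ι k p.1) + p.2 • z := rfl

/-- The Lie subalgebra `𝔤 + k z` of a usual Hopf-Ore extension of `U(𝔤)`. -/
noncomputable def IsUsualType.lieSubalgebra (h : IsUsualType B χ d ι' z) : LieSubalgebra k H where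
  __ := LinearMap.range (primitiveMap ι' z)
  lie_mem' := by
    rintro _ _ ⟨⟨x, c⟩, rfl⟩ ⟨⟨y, e⟩, rfl⟩
    refine ⟨(⁅x, y⁆ + c • d y - e • d x, c * χ y - e * χ x), ?_⟩
    rw [LieRing.of_associative_ring_bracket]
    simp only [primitiveMap_apply, map_add, map_sub, map_smul, ι_lie, map_mul, add_mul, mul_add,
      smul_mul_assoc, mul_smul_comm, h.rel, smul_add, sub_smul, mul_smul]
    module

theorem IsUsualType.mem_lieSubalgebra (h : IsUsualType B χ d ι' z) {a : H} :
    a ∈ h.lieSubalgebra ↔ ∃ (x : g) (c : k), ι' (ι k x) + c • z = a :=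
  ⟨fun ⟨⟨x, c⟩, hp⟩ => ⟨x, c, hp⟩, fun ⟨x, c, hp⟩ => ⟨(x, c), hp⟩⟩

/-- The embedding of `𝔤` in the Lie algebra `𝔤 + k z`. -/
noncomputable def IsUsualType.lieEmbedding (h : IsUsualType B χ d ι' z) :
    g →ₗ⁅k⁆ h.lieSubalgebra where
  toFun x := ⟨ι' (ι k x), h.mem_lieSubalgebra.2 ⟨x, 0, by rw [zero_smul, add_zero]⟩⟩
  map_add' x y := Subtype.ext (by simp only [map_add]; rfl)
  map_smul' r x := Subtype.ext (by simp only [map_smul]; rfl)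
  map_lie' {x y} := Subtype.ext (by
    change ι' (ι k ⁅x, y⁆) = ⁅ι' (ι k x), ι' (ι k y)⁆
    rw [LieRing.of_associative_ring_bracket, ι_lie, map_sub, map_mul, map_mul])

theorem IsUsualType.finrank_lieSubalgebra (hg : Module.finrank k g = 2) (hB : IsNormalizedBasis B)
    (h : IsUsualType B χ d ι' z) : Module.finrank k h.lieSubalgebra = 3 := by
  have : Module.Finite k g := Module.finite_of_finrank_pos (by omega)
  have hinj : Function.Injective (primitiveMap ι' z) := by
    rw [injective_iff_map_eq_zero]
    rintro ⟨x, c⟩ hx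
    obtain ⟨rfl, rfl⟩ := h.linear_injective hB hx
    rfl
  have h3 := LinearMap.finrank_range_of_inj hinj
  rw [Module.finrank_prod, hg, Module.finrank_self] at h3
  exact h3

theorem IsUsualType.finrank_range_lieEmbedding (hg : Module.finrank k g = 2)
    (hB : IsNormalizedBasis B) (h : IsUsualType B χ d ι' z) :
    Module.finrank k h.lieEmbedding.range = 2 := by
  have hinj : Function.Injective (h.lieEmbedding : g →ₗ[k] h.lieSubalgebra) := by
    rw [injective_iff_map_eq_zero]
    intro x hx
    have hx' : ι' (ι k x) = 0 := congrArg Subtype.val hx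
    exact (h.linear_injective hB (c := 0) (by rw [zero_smul, add_zero, hx'])).1
  rw [← hg]
  exact LinearMap.finrank_range_of_inj hinj

/-- A usual Hopf-Ore extension of `U(𝔤)` is the enveloping algebra of a Lie algebra `𝔤 + k z`. The
Lie algebra is taken inside a second extension `O` with the same data, which may live in another
universe. -/
theorem IsUsualType.nonempty_bialgEquiv {O : Type*} [Ring O] [HopfAlgebra k O]
    {ι₀ : UniversalEnvelopingAlgebra k g →ₐc[k] O} {z₀ : O} (h : IsUsualType B χ d ι' z)
    (h₀ : IsUsualType B χ d ι₀ z₀) :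
    Nonempty (H ≃ₐc[k] UniversalEnvelopingAlgebra k h₀.lieSubalgebra) := by
  obtain ⟨G, hGι, hGz⟩ := h₀.exists_algHom (ι' : _ →ₐ[k] H) z h.rel
  let Φ : UniversalEnvelopingAlgebra k h₀.lieSubalgebra →ₐ[k] H :=
    G.comp (lift k h₀.lieSubalgebra.incl)
  have hΦ : ∀ l : h₀.lieSubalgebra, Φ (ι k l) = G l := fun l =>
    congrArg G (lift_ι_apply k _ l)
  let ζ : h₀.lieSubalgebra := ⟨z₀, h₀.mem_lieSubalgebra.2 ⟨0, 1, by simp⟩⟩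
  let f : UniversalEnvelopingAlgebra k g →ₐ[k] UniversalEnvelopingAlgebra k h₀.lieSubalgebra :=
    lift k ((ι k).comp h₀.lieEmbedding)
  have hf : ∀ x, f (ι k x) = ι k (h₀.lieEmbedding x) := fun x => lift_ι_apply k _ x
  obtain ⟨Ψ, hΨι, hΨz⟩ := h.exists_algHom f (ι k ζ) (by
    intro x
    have hlie : ⁅ζ, h₀.lieEmbedding x⁆ = χ x • ζ + h₀.lieEmbedding (d x) := Subtype.ext (by
      change ⁅z₀, ι₀ (ι k x)⁆ = χ x • z₀ + ι₀ (ι k (d x))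
      rw [LieRing.of_associative_ring_bracket, h₀.rel]
      abel)
    have h1 := ι_lie (k := k) ζ (h₀.lieEmbedding x)
    rw [hlie, map_add, map_smul, eq_sub_iff_add_eq'] at h1
    rw [hf, hf, ← h1, add_assoc])
  have hΦΨ : Φ.comp Ψ = AlgHom.id k H := h.algHom_ext
    (fun x => by
      rw [AlgHom.comp_apply, hΨι, hf, hΦ]
      exact hGι _)
    (by
      rw [AlgHom.comp_apply, hΨz, hΦ]
      exact hGz)
  have hΨΦ : Ψ.comp Φ = AlgHom.id k _ := algHom_eq fun l => by
    obtain ⟨x, c, hl⟩ := h₀.mem_lieSubalgebra.1 l.2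
    have hl' : l = h₀.lieEmbedding x + c • ζ := Subtype.ext hl.symm
    rw [AlgHom.comp_apply, hΦ, ← hl, map_add, map_smul, hGz, AlgHom.id_apply, hl']
    have : G (ι₀ (ι k x)) = ι' (ι k x) := hGι _
    rw [this, map_add, map_smul, hΨι, hΨz, hf, map_add, map_smul]
  let e : H ≃ₐ[k] UniversalEnvelopingAlgebra k h₀.lieSubalgebra := AlgEquiv.ofAlgHom Ψ Φ hΨΦ hΦΨ
  have heι : ∀ x, e (ι' (ι k x)) = ι k (h₀.lieEmbedding x) := fun x => (hΨι _).trans (hf x)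
  have hez : e z = ι k ζ := hΨz
  have hcounitz : Coalgebra.counit (R := k) z = 0 := counit_eq_zero_of_primitive h.comul_z
  exact ⟨BialgEquiv.ofAlgEquiv e
    (h.algHom_ext
      (fun x => by
        change Coalgebra.counit (R := k) (e (ι' (ι k x))) = Coalgebra.counit (R := k) (ι' (ι k x))
        rw [heι, counit_ι, CoalgHomClass.counit_comp_apply, counit_ι])
      (by
        change Coalgebra.counit (R := k) (e z) = Coalgebra.counit (R := k) z
        rw [hez, counit_ι, hcounitz]))
    (h.algHom_ext
      (fun x => by
        change Algebra.TensorProduct.map (e : H →ₐ[k] _) (e : H →ₐ[k] _)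
          (Coalgebra.comul (R := k) (ι' (ι k x))) = Coalgebra.comul (R := k) (e (ι' (ι k x)))
        rw [heι, comul_ι, IsGeneralizedHopfOre.comul_ι, comul_ι]
        simp only [map_add, Algebra.TensorProduct.map_tmul, map_one]
        have : (e : H →ₐ[k] _) ((ι' : UniversalEnvelopingAlgebra k g →ₐ[k] H) (ι k x)) =
          ι k (h₀.lieEmbedding x) := heι x
        rw [this])
      (by
        change Algebra.TensorProduct.map (e : H →ₐ[k] _) (e : H →ₐ[k] _)
          (Coalgebra.comul (R := k) z) = Coalgebra.comul (R := k) (e z)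
        rw [hez, comul_ι, h.comul_z]
        simp only [map_add, Algebra.TensorProduct.map_tmul, map_one]
        have : (e : H →ₐ[k] _) z = ι k ζ := hez
        rw [this]))⟩

end UsualType

section Subalgebra

variable {L : Type w} [LieRing L] [LieAlgebra k L] {K : LieSubalgebra k L}

/-- A codimension-one subalgebra is the kernel of a functional. -/
theorem exists_functional_of_finrank (hL : Module.finrank k L = 3) (hK : Module.finrank k K = 2) :
    ∃ (c : L →ₗ[k] k) (z : L), c z = 1 ∧ ∀ x, x ∈ K ↔ c x = 0 := by
  have : Module.Finite k L := Module.finite_of_finrank_pos (by omega)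
  have hlt : K.toSubmodule < ⊤ := by
    rw [lt_top_iff_ne_top]
    intro htop
    have h2 : Module.finrank k K.toSubmodule = 2 := hK
    rw [htop, finrank_top, hL] at h2
    omega
  obtain ⟨f, hf0, hf⟩ := Submodule.exists_le_ker_of_lt_top K.toSubmodule hlt
  obtain ⟨z, hz⟩ : ∃ z, f z ≠ 0 := by
    by_contra! hcon
    exact hf0 (LinearMap.ext hcon)
  have hrank := f.finrank_range_add_finrank_ker
  have hr1 : Module.finrank k (LinearMap.range f) = 1 := by
    rw [LinearMap.range_eq_top.2 (LinearMap.surjective (fun h => hz (by rw [h]; rfl))),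
      finrank_top, Module.finrank_self]
  have heq : K.toSubmodule = LinearMap.ker f :=
    Submodule.eq_of_le_of_finrank_eq hf (by
      have h2 : Module.finrank k K.toSubmodule = 2 := hK
      omega)
  refine ⟨(f z)⁻¹ • f, z, by simp [hz], fun x => ?_⟩
  rw [← LieSubalgebra.mem_toSubmodule, heq, LinearMap.mem_ker]
  simp [hz]

/-- The enveloping algebra of a three-dimensional Lie algebra is a usual Hopf-Ore extension of the
enveloping algebra of any two-dimensional subalgebra. -/
theorem exists_isUsualType_of_subalgebra (hL : Module.finrank k L = 3)
    (B : Module.Basis (Fin 2) k K) (hK : Module.finrank k K = 2) :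
    ∃ (χ : LieAlgebra.LieCharacter k K) (d : K →ₗ[k] K)
      (ι' : UniversalEnvelopingAlgebra k K →ₐc[k] UniversalEnvelopingAlgebra k L)
      (z : UniversalEnvelopingAlgebra k L), IsUsualType B χ d ι' z := by
  obtain ⟨c, z, hcz, hc⟩ := exists_functional_of_finrank hL hK
  have hcK : ∀ u : K, c u = 0 := fun u => (hc u).1 u.2
  -- the projection to `K` along `z`
  let p : L →ₗ[k] K := LinearMap.codRestrict K.toSubmodule
    (LinearMap.id - (LinearMap.toSpanSingleton k L z) ∘ₗ c) (fun x => by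
      change _ ∈ K
      rw [hc]
      simp [hcz])
  have hp : ∀ x, (p x : L) = x - c x • z := fun x => rfl
  have hdec : ∀ x, x = (p x : L) + c x • z := fun x => by rw [hp, sub_add_cancel]
  have hpu : ∀ (u : K) (r : k), p ((u : L) + r • z) = u := fun u r => Subtype.ext (by
    rw [hp, map_add, map_smul, hcK, hcz, zero_add, smul_eq_mul, mul_one, add_sub_cancel_right])
  have hcu : ∀ (u : K) (r : k), c ((u : L) + r • z) = r := fun u r => by
    rw [map_add, map_smul, hcK, hcz, zero_add, smul_eq_mul, mul_one]
  let adz : K →ₗ[k] L := (LieAlgebra.ad k L z : L →ₗ[k] L) ∘ₗ K.toSubmodule.subtype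
  let d : K →ₗ[k] K := p ∘ₗ adz
  let χ₀ : K →ₗ[k] k := c ∘ₗ adz
  have hz : ∀ u : K, ⁅z, (u : L)⁆ = (d u : L) + χ₀ u • z := fun u => hdec _
  have hjac : ∀ u v : K, ⁅z, ((⁅u, v⁆ : K) : L)⁆ =
      ((⁅d u, v⁆ + ⁅u, d v⁆ + χ₀ u • d v - χ₀ v • d u : K) : L) + (0 : k) • z := by
    intro u v
    rw [LieSubalgebra.coe_bracket, leibniz_lie, hz, hz, add_lie, smul_lie, hz, lie_add, lie_smul,
      ← lie_skew (u : L) z, hz]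
    push_cast
    module
  let χ : LieAlgebra.LieCharacter k K :=
    { χ₀ with
      map_lie' := fun {u v} => by
        change c ⁅z, ((⁅u, v⁆ : K) : L)⁆ = _
        rw [hjac, hcu, LieRing.of_associative_ring_bracket, mul_comm, sub_self] }
  have hχ : ∀ u, χ u = χ₀ u := fun u => rfl
  have hd : IsTwistedDerivation B χ d := by
    change p ⁅z, ((⁅B 0, B 1⁆ : K) : L)⁆ = _
    rw [hjac, hpu]
    rfl
  obtain ⟨δ, hδ, hδι⟩ := hd.exists_extension
  obtain ⟨O, _, _, ι₀, z₀, h₀⟩ := exists_isOreExtension (winding χ) δ hδ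
  let j : UniversalEnvelopingAlgebra k K →ₐ[k] UniversalEnvelopingAlgebra k L :=
    lift k ((ι k).comp K.incl)
  have hj : ∀ u : K, j (ι k u) = ι k (u : L) := fun u => lift_ι_apply k _ u
  have hz₀ : ∀ u : K, z₀ * ι₀ (ι k u) = ι₀ (ι k u) * z₀ + χ₀ u • z₀ + ι₀ (ι k (d u)) := by
    intro u
    rw [h₀.rel, hδι, winding_ι, map_add, map_smul, map_one, add_mul, smul_mul_assoc, one_mul, hχ]
  let γ : L →ₗ⁅k⁆ O :=
    { toFun := fun x => ι₀ (ι k (p x)) + c x • z₀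
      map_add' := fun x y => by simp only [map_add, add_smul]; abel
      map_smul' := fun r x => by simp only [map_smul, smul_eq_mul, mul_smul, smul_add]; rfl
      map_lie' := fun {x y} => by
        have hxy : ⁅x, y⁆ = ((⁅p x, p y⁆ + c x • d (p y) - c y • d (p x) : K) : L) +
            (c x * χ₀ (p y) - c y * χ₀ (p x)) • z := by
          conv_lhs => rw [hdec x, hdec y]
          rw [add_lie, lie_add, lie_add, smul_lie, smul_lie, lie_smul, lie_smul, lie_self, hz,
            ← lie_skew _ z, hz]
          push_cast
          module
        rw [hxy, hpu, hcu, LieRing.of_associative_ring_bracket]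
        simp only [map_add, map_sub, map_smul, ι_lie, map_mul, add_mul, mul_add,
          smul_mul_assoc, mul_smul_comm, hz₀, smul_add, sub_smul, mul_smul]
        module }
  have hG : ∀ x, lift k γ (ι k x) = ι₀ (ι k (p x)) + c x • z₀ := fun x => lift_ι_apply k _ x
  have hGj : (lift k γ).comp j = ι₀ := algHom_eq fun u => by
    rw [AlgHom.comp_apply, hj, hG, hcK, zero_smul, add_zero]
    congr 2
    simpa using hpu u 0
  have hore : IsOreExtension j (ι k z) (winding χ) δ := by
    refine h₀.of_algHom (fun a => ?_) (lift k γ) (fun a => AlgHom.congr_fun hGj a) ?_ ?_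
    · refine mem_of_ι_mem k (oreRelSubalgebra hδ j (ι k z)) (fun u => ?_) a
      change _ * _ = _ * _ + _
      rw [hδι, winding_ι, map_add, map_smul, map_one, hj, hj, add_mul, smul_mul_assoc, one_mul,
        ← sub_eq_iff_eq_add', hχ]
      have := ι_lie (k := k) z (u : L)
      rw [hz, map_add, map_smul] at this
      rw [← sub_sub, ← this, add_sub_cancel_right]
    · rw [hG, hcz, one_smul]
      have : p z = 0 := by simpa using hpu 0 1
      rw [this, map_zero, map_zero, zero_add]
    · intro S hS hzS
      refine mem_of_ι_mem k S fun x => ?_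
      rw [hdec x, map_add, map_smul, ← hj]
      exact S.add_mem (hS _) (S.smul_mem hzS _)
  let ι' : UniversalEnvelopingAlgebra k K →ₐc[k] UniversalEnvelopingAlgebra k L :=
    BialgHom.ofAlgHom j
      (algHom_eq fun u => by
        simp only [AlgHom.comp_apply, Bialgebra.counitAlgHom_apply, hj, counit_ι])
      (algHom_eq fun u => by
        simp only [AlgHom.comp_apply, Bialgebra.comulAlgHom_apply, hj, comul_ι, map_add,
          Algebra.TensorProduct.map_tmul, map_one])
  have hgen : IsGeneralizedHopfOre ι' (ι k z) (winding χ) δ 1 1 (ι k 0) (ι k 0) := by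
    refine ⟨hore, ?_⟩
    have h0 : ι k (0 : K) = 0 := map_zero _
    rw [comul_ι, map_one, h0, map_zero, TensorProduct.zero_tmul, add_zero]
  have hext := hgen.isHopfOreExtension rfl Iff.rfl
  rw [map_zero] at hext
  exact ⟨χ, d, ι', ι k z, hd, δ, hδι, hext⟩

/-- Over an algebraically closed field, `span(x, y)` is a subalgebra for any `x ≠ 0` and any
eigenvector of `ad x` on `L / k x`, represented by `y`. -/
theorem exists_subalgebra_finrank_two [IsAlgClosed k] (hL : Module.finrank k L = 3) :
    ∃ K : LieSubalgebra k L, Module.finrank k K = 2 := by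
  have : Module.Finite k L := Module.finite_of_finrank_pos (by omega)
  have : Nontrivial L := Module.nontrivial_of_finrank_pos (R := k) (by omega)
  obtain ⟨x, hx⟩ := exists_ne (0 : L)
  let V : Submodule k L := k ∙ x
  have hV : Module.finrank k V = 1 := finrank_span_singleton hx
  have hquot := V.finrank_quotient_add_finrank
  have : Nontrivial (L ⧸ V) := Module.nontrivial_of_finrank_pos (R := k) (by omega)
  let T : Module.End k (L ⧸ V) := V.mapQ V (LieAlgebra.ad k L x) (by
    rw [Submodule.span_singleton_le_iff_mem]
    simp)
  obtain ⟨μ, hμ⟩ := Module.End.exists_eigenvalue T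
  obtain ⟨q, hq⟩ := hμ.exists_hasEigenvector
  obtain ⟨y, rfl⟩ := V.mkQ_surjective q
  have hy : y ∉ V := fun hy => hq.2 ((Submodule.Quotient.mk_eq_zero V).2 hy)
  obtain ⟨r, hr⟩ : ∃ r : k, ⁅x, y⁆ = r • x + μ • y := by
    have h1 := hq.apply_eq_smul
    rw [← map_smul] at h1
    have h2 : ⁅x, y⁆ - μ • y ∈ V := (Submodule.Quotient.eq V).1 h1
    obtain ⟨r, hr⟩ := Submodule.mem_span_singleton.1 h2
    exact ⟨r, by rw [hr, sub_add_cancel]⟩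
  have hli : LinearIndependent k ![x, y] := by
    rw [LinearIndependent.pair_iff' hx]
    intro a ha
    exact hy (Submodule.mem_span_singleton.2 ⟨a, ha⟩)
  let K : LieSubalgebra k L :=
    { Submodule.span k {x, y} with
      lie_mem' := by
        intro a b ha hb
        obtain ⟨a₁, a₂, rfl⟩ := Submodule.mem_span_pair.1 ha
        obtain ⟨b₁, b₂, rfl⟩ := Submodule.mem_span_pair.1 hb
        refine Submodule.mem_span_pair.2
          ⟨(a₁ * b₂ - a₂ * b₁) * r, (a₁ * b₂ - a₂ * b₁) * μ, ?_⟩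
        simp only [lie_add, add_lie, lie_smul, smul_lie, lie_self]
        rw [← lie_skew y x, hr]
        module }
  refine ⟨K, ?_⟩
  have h2 := finrank_span_eq_card hli
  rw [Matrix.range_cons, Matrix.range_cons, Matrix.range_empty, Set.union_empty,
    Set.singleton_union, Fintype.card_fin] at h2
  exact h2

end Subalgebra

end EnvelopingAlgebras

/-! ### Generalized Hopf-Ore extensions of `U(𝔤)` for two-dimensional `𝔤` -/

theorem proposition2p8 {k : Type u} [Field k] [CharZero k] {g : Type v} [LieRing g]
    [LieAlgebra k g] (hg : Module.finrank k g = 2) :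
    -- `𝔤` has a basis `a, b` with `[a, b] = 0` or `[a, b] = a`
    (∃ B : Module.Basis (Fin 2) k g, IsNormalizedBasis B) ∧
    -- the classification
    (∀ (H : Type w) [Ring H] [HopfAlgebra k H]
      (ι : UniversalEnvelopingAlgebra k g →ₐc[k] H) (z : H)
      (τ : UniversalEnvelopingAlgebra k g →ₐ[k] UniversalEnvelopingAlgebra k g)
      (δ : UniversalEnvelopingAlgebra k g →ₗ[k] UniversalEnvelopingAlgebra k g)
      (r₁ r₂ x y : UniversalEnvelopingAlgebra k g),
      IsGeneralizedHopfOre ι z τ δ r₁ r₂ x y →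
        r₁ = 1 ∧ r₂ = 1 ∧
        ∀ B : Module.Basis (Fin 2) k g, IsNormalizedBasis B →
          ∃ (H' : Type w) (_ : Ring H') (_ : HopfAlgebra k H')
            (ι' : UniversalEnvelopingAlgebra k g →ₐc[k] H') (z' : H'),
            AreIsomorphicExtensions ι ι' ∧
            ((∃ (χ : LieAlgebra.LieCharacter k g) (d : g →ₗ[k] g), IsUsualType B χ d ι' z') ∨
              (∃ d : g →ₗ[k] g, IsAbelianType B d ι' z') ∨
              (∃ η ζ : k, IsNonabelianType B η ζ ι' z'))) ∧
    -- all the listed extensions exist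
    (∀ B : Module.Basis (Fin 2) k g, IsNormalizedBasis B →
      (∀ (χ : LieAlgebra.LieCharacter k g) (d : g →ₗ[k] g), IsTwistedDerivation B χ d →
        ∃ (H : Type (max u v)) (_ : Ring H) (_ : HopfAlgebra k H)
          (ι : UniversalEnvelopingAlgebra k g →ₐc[k] H) (z : H), IsUsualType B χ d ι z) ∧
      (⁅B 0, B 1⁆ = 0 → ∀ d : g →ₗ[k] g,
        ∃ (H : Type (max u v)) (_ : Ring H) (_ : HopfAlgebra k H)
          (ι : UniversalEnvelopingAlgebra k g →ₐc[k] H) (z : H), IsAbelianType B d ι z) ∧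
      (⁅B 0, B 1⁆ = B 0 → ∀ η ζ : k,
        ∃ (H : Type (max u v)) (_ : Ring H) (_ : HopfAlgebra k H)
          (ι : UniversalEnvelopingAlgebra k g →ₐc[k] H) (z : H), IsNonabelianType B η ζ ι z)) ∧
    -- those of the first type are enveloping algebras of `3`-dimensional Lie algebras
    (∀ (B : Module.Basis (Fin 2) k g), IsNormalizedBasis B →
      ∀ (χ : LieAlgebra.LieCharacter k g) (d : g →ₗ[k] g)
      (H : Type w) [Ring H] [HopfAlgebra k H]
      (ι : UniversalEnvelopingAlgebra k g →ₐc[k] H) (z : H), IsUsualType B χ d ι z →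
        ∃ (L : Type (max u v)) (_ : LieRing L) (_ : LieAlgebra k L),
          Module.finrank k L = 3 ∧
          (∃ K : LieSubalgebra k L, Module.finrank k K = 2) ∧
          Nonempty (H ≃ₐc[k] UniversalEnvelopingAlgebra k L)) ∧
    -- conversely, the enveloping algebra of a `3`-dimensional Lie algebra is of the first type over
    -- `U(K)` for each `2`-dimensional subalgebra `K`, and if `k` is algebraically closed then
    -- there is such a subalgebra
    (∀ (L : Type w) [LieRing L] [LieAlgebra k L], Module.finrank k L = 3 →
      (∀ K : LieSubalgebra k L, Module.finrank k K = 2 →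
        ∃ B : Module.Basis (Fin 2) k K, IsNormalizedBasis B ∧
          ∃ (χ : LieAlgebra.LieCharacter k K) (d : K →ₗ[k] K)
            (ι : UniversalEnvelopingAlgebra k K →ₐc[k] UniversalEnvelopingAlgebra k L)
            (z : UniversalEnvelopingAlgebra k L), IsUsualType B χ d ι z) ∧
      (IsAlgClosed k → ∃ K : LieSubalgebra k L, Module.finrank k K = 2)) := by
  obtain ⟨B₀, hB₀⟩ := exists_isNormalizedBasis hg
  refine ⟨⟨B₀, hB₀⟩, ?_, ?_, ?_, ?_⟩
  · intro H _ _ ι z τ δ r₁ r₂ x y h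
    obtain ⟨rfl, rfl⟩ := h.eq_one_and_eq_one hB₀
    refine ⟨rfl, rfl, fun B hB => ?_⟩
    obtain ⟨z', h'⟩ := h.exists_type hB
    exact ⟨H, _, _, ι, z', ⟨BialgEquiv.refl k H, Set.image_id _⟩, h'⟩
  · intro B _
    exact ⟨fun χ d hd => exists_isUsualType χ d hd, fun h0 d => exists_isAbelianType h0 d,
      fun h1 η ζ => exists_isNonabelianType h1 η ζ⟩
  · intro B hB χ d H _ _ ι z h
    obtain ⟨O, _, _, ι₀, z₀, h₀⟩ := exists_isUsualType χ d h.1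
    exact ⟨h₀.lieSubalgebra, _, _, h₀.finrank_lieSubalgebra hg hB,
      ⟨h₀.lieEmbedding.range, h₀.finrank_range_lieEmbedding hg hB⟩, h.nonempty_bialgEquiv h₀⟩
  · intro L _ _ hL
    refine ⟨fun K hK => ?_, fun _ => exists_subalgebra_finrank_two hL⟩
    obtain ⟨B, hB⟩ := exists_isNormalizedBasis hK
    exact ⟨B, hB, exists_isUsualType_of_subalgebra hL B hK⟩
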